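/- **Setting.** Let $d\ge 1$. All directed trees are leafless (every vertex has at least one child), rooted, and locally finite (every vertex has finitely many children); $\mathsf{root}_j$ denotes the root of $\mathscr T_j=(V_j,\mathcal E_j)$. The depth $\mathsf d_v$ of a vertex $v$ of a tree is its distance from the root, the $n$-th generation $\mathcal G_n$ is the set of vertices of depth $n$, and $\mathsf{sib}(v)$ is the set of children of the parent of $v$ (so $v\in\mathsf{sib}(v)$ for $v$ not the root, while the root has no siblings). The branching index of a tree is $0$ if no vertex has at least two children, and otherwise $1$ plus the supremum of the depths of the vertices with at least two children. The directed Cartesian product $\mathscr T$ of $\mathscr T_1,\dots,\mathscr T_d$ has vertex set $V=V_1\times\cdots\times V_d$, and it is of finite joint branching index if each $\mathscr T_j$ has finite branching index. For $v\in V$ put $\mathsf d_v=(\mathsf d_{v_1},\dots,\mathsf d_{v_d})\in\mathbb N^d$ and $|\mathsf d_v|=\sum_j\mathsf d_{v_j}$; let $\mathsf{Chi}_j(v)$ and $\mathsf{sib}_j(v)$ be the sets of vertices obtained from $v$ by replacing $v_j$ by one of its children, respectively one of its siblings. For $F\subseteq\{1,\dots,d\}$ let $\Phi_F$ be the set of $v\in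 V$ with $v_j\ne\mathsf{root}_j$ exactly for $j\in F$; for $u\in\Phi_F$ let $\mathsf{sib}_F(u)$ be the set of $w\in V$ with $w_j\in\mathsf{sib}(u_j)$ for $j\in F$ and $w_j=u_j$ for $j\notin F$. These sets partition $\Phi_F$; let $\Omega_F$ be any set consisting of exactly one element of each of the classes $\mathsf{sib}_F(u)$, $u\in\Phi_F$. Let $a$ be a positive integer. The Drury–Arveson-type multishift $(S_1,\dots,S_d)$ on $\ell^2(V)$ is given by $(S_jf)(w)=\lambda_j(w)f(v)$ if $w\in\mathsf{Chi}_j(v)$ and $(S_jf)(w)=0$ if $w_j=\mathsf{root}_j$, where $$\lambda_j(w)=\sqrt{\frac{\mathfrak c_a(|\mathsf d_v|)}{\operatorname{card}\mathsf{Chi}_j(v)}}\sqrt{\frac{\mathsf d_{v_j}+1}{|\mathsf d_v|+d}}\quad (w\in\mathsf{Chi}_j(v)),\qquad \mathfrak c_a(t)=\frac{t+d}{t+a}.$$ Let $E=\bigcap_{j=1}^d\ker S_j^*$. For $u\in\Omega_F$ let $\mathcal L_{u,F}$ be the space of all $f\in\ell^2(V)$ supported in $\mathsf{sib}_F(u)$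 such that, for all $j\in F$ and $v\in\mathsf{sib}_F(u)$, $$\sum_{w\in\mathsf{sib}_j(v')}f(w)\lambda_j(w)=0,$$ where $v'_j=u_j$, $v'_i=v_i$ for $i\in F\setminus\{j\}$, and $v'_i=\mathsf{root}_i$ for $i\notin F$; one has $\mathcal L_{u,F}\subseteq E$. If $\mathscr T$ is of finite joint branching index, $\mathscr H_{\mathfrak c_a}(\mathscr T)$ is the reproducing kernel Hilbert space of $E$-valued functions on the open unit ball $\mathbb B^d$ of $\mathbb C^d$ with reproducing kernel $$\kappa(z,w)=\sum_{F\subseteq\{1,\dots,d\}}\ \sum_{u\in\Omega_F}\Big(\sum_{\alpha\in\mathbb N^d}\frac{\mathsf d_u!}{(\mathsf d_u+\alpha)!}\prod_{j=0}^{|\alpha|-1}(|\mathsf d_u|+a+j)\,z^\alpha\overline w^\alpha\Big)P_{\mathcal L_{u,F}},$$ where $P_{\mathcal L_{u,F}}$ is the orthogonal projection of $E$ onto $\mathcal L_{u,F}$. Let $\mathscr M_{z_k}$ be the operator of multiplication by the coordinate function $z_k$. Two such Hilbert modules $\mathscr H_{\mathfrak c_a}(\mathscr T^{(1)})$ and $\mathscr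 H_{\mathfrak c_a}(\mathscr T^{(2)})$ are isomorphic if there is a unitary map $U:\mathscr H_{\mathfrak c_a}(\mathscr T^{(1)})\to\mathscr H_{\mathfrak c_a}(\mathscr T^{(2)})$ with $U\mathscr M^{(1)}_{z_k}=\mathscr M^{(2)}_{z_k}U$ for $k=1,\dots,d$. **Theorem 1.4.** Let $a,d$ be positive integers with $ad\ne1$. For $j=1,2$ let $\mathscr T^{(j)}$ be the directed Cartesian product of leafless, locally finite, rooted directed trees $\mathscr T^{(j)}_1,\dots,\mathscr T^{(j)}_d$, of finite joint branching index, with the associated $\Omega^{(j)}_F$ and $\mathcal L^{(j)}_{u,F}$. The following are equivalent: (i) The Hilbert modules $\mathscr H_{\mathfrak c_a}(\mathscr T^{(1)})$ and $\mathscr H_{\mathfrak c_a}(\mathscr T^{(2)})$ are isomorphic. (ii) For all $\alpha\in\mathbb N^d$ and $F\subseteq\{1,\dots,d\}$, $$\sum_{u\in\Omega^{(1)}_F,\ \mathsf d_u=\alpha}\dim\mathcal L^{(1)}_{u,F}=\sum_{v\in\Omega^{(2)}_F,\ \mathsf d_v=\alpha}\dim\mathcal L^{(2)}_{v,F}.$$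 (iii) For all $n\in\mathbb N$ and $l=1,\dots,d$, $$\sum_{u\in\Omega^{(1)}_{\{l\}},\ \mathsf d_u=n\epsilon_l}(\operatorname{card}\mathsf{sib}_l(u)-1)=\sum_{v\in\Omega^{(2)}_{\{l\}},\ \mathsf d_v=n\epsilon_l}(\operatorname{card}\mathsf{sib}_l(v)-1),$$ where $\epsilon_l$ is the $l$-th standard unit vector of $\mathbb N^d$. (iv) For all $n\in\mathbb N$ and $l=1,\dots,d$, $\operatorname{card}\mathcal G_n(\mathscr T^{(1)}_l)=\operatorname{card}\mathcal G_n(\mathscr T^{(2)}_l)$. -/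

import Mathlib

noncomputable section

namespace DruryArveson

open scoped InnerProductSpace ComplexConjugate Nat

/-! ### Directed trees -/

/-- A leafless, locally finite, rooted directed tree with vertex set `V`:
a connected directed graph without circuits, with a root, in which every vertex has at most one
parent, every vertex has at least one child and only finitely many children.
(Connectedness forces every vertex other than the root to have a parent, so the root is unique.
Such a tree is countably infinite.) -/
structure RootedTree (V : Type*) where
  /-- `Edge u v` means that `(u, v)` is a directed edge. -/
  Edge : V → V → Prop
  /-- The root. -/
  root : V
  no_circuit : ∀ v, ¬ Relation.TransGen Edge v v
  connected : ∀ u v, Relation.EqvGen Edge u v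
  root_not_child : ∀ u, ¬ Edge u root
  parent_unique : ∀ u u' v, Edge u v → Edge u' v → u = u'
  leafless : ∀ u, ∃ v, Edge u v
  locally_finite : ∀ u, {v | Edge u v}.Finite

namespace RootedTree

variable {V : Type*} (T : RootedTree V)

/-- The set of children of a vertex. -/
def children (v : V) : Set V := {w | T.Edge v w}

open Classical in
/-- The parent of a vertex; by convention the root is sent to itself. -/
def parent (v : V) : V := if h : ∃ u, T.Edge u v then h.choose else v

/-- The siblings of `v`, that is, the children of the parent of `v` (so `v` is a sibling of itself
if `v` is not the root, and the root has no siblings). -/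
def sib (v : V) : Set V := {w | ∃ p, T.Edge p v ∧ T.Edge p w}

/-- The set of descendants of the root obtained by passing `n` times to children. -/
def rootChildren : ℕ → Set V
  | 0 => {T.root}
  | n + 1 => {w | ∃ v ∈ rootChildren n, T.Edge v w}

/-- The depth of a vertex: the (unique) `n` such that the vertex is reached from the root by
passing `n` times to children. -/
def depth (v : V) : ℕ := sInf {n | v ∈ T.rootChildren n}

/-- The `n`-th generation. -/
def generation (n : ℕ) : Set V := {v | T.depth v = n}

/-- The set of branching vertices: those with at least two children. -/
def branching : Set V := {v | 2 ≤ (T.children v).encard}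

/-- The branching index: `0` if there is no branching vertex, and otherwise one plus the supremum
of the depths of the branching vertices. -/
def branchingIndex : ℕ∞ := ⨆ v ∈ T.branching, ((T.depth v : ℕ∞) + 1)

variable {T}

lemma exists_rootChildren (v : V) : ∃ n, v ∈ T.rootChildren n := by
  have key : ∀ u w, Relation.EqvGen T.Edge u w →
      ((∃ n, u ∈ T.rootChildren n) ↔ ∃ n, w ∈ T.rootChildren n) := by
    intro u w h
    induction h with
    | rel x y h =>
      constructor
      · rintro ⟨n, hn⟩
        exact ⟨n + 1, x, hn, h⟩
      · rintro ⟨n, hn⟩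
        cases n with
        | zero =>
          have : y = T.root := hn
          exact absurd (this ▸ h) (T.root_not_child x)
        | succ n =>
          obtain ⟨x', hx', he⟩ := hn
          exact ⟨n, T.parent_unique _ _ _ he h ▸ hx'⟩
    | refl => exact Iff.rfl
    | symm _ _ _ ih => exact ih.symm
    | trans _ _ _ _ _ ih₁ ih₂ => exact ih₁.trans ih₂
  exact (key _ _ (T.connected T.root v)).1 ⟨0, rfl⟩

lemma rootChildren_unique {v : V} {m n : ℕ} (hm : v ∈ T.rootChildren m)
    (hn : v ∈ T.rootChildren n) : m = n := by
  induction m generalizing v n with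
  | zero =>
    have hv : v = T.root := hm
    cases n with
    | zero => rfl
    | succ n =>
      obtain ⟨x, _, he⟩ := hn
      exact absurd (hv ▸ he) (T.root_not_child x)
  | succ m ih =>
    obtain ⟨x, hx, he⟩ := hm
    cases n with
    | zero =>
      have hv : v = T.root := hn
      exact absurd (hv ▸ he) (T.root_not_child x)
    | succ n =>
      obtain ⟨y, hy, he'⟩ := hn
      rw [T.parent_unique _ _ _ he' he] at hy
      rw [ih hx hy]

/-- The depth is the unique number of steps from the root. -/
lemma mem_rootChildren_iff {v : V} {n : ℕ} : v ∈ T.rootChildren n ↔ T.depth v = n := by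
  have h : v ∈ T.rootChildren (T.depth v) := Nat.sInf_mem (exists_rootChildren v)
  exact ⟨fun hn => rootChildren_unique h hn, fun hn => hn ▸ h⟩

lemma parent_eq {u v : V} (h : T.Edge u v) : T.parent v = u := by
  have hex : ∃ u, T.Edge u v := ⟨u, h⟩
  simp only [parent, dif_pos hex]
  exact T.parent_unique _ _ _ hex.choose_spec h

lemma edge_parent {v : V} (h : v ≠ T.root) : T.Edge (T.parent v) v := by
  obtain ⟨n, hn⟩ := exists_rootChildren (T := T) v
  cases n with
  | zero => exact absurd hn h
  | succ n =>
    obtain ⟨u, _, hu⟩ := hn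
    rwa [parent_eq hu]

lemma finite_sib (v : V) : (T.sib v).Finite := by
  by_cases h : ∃ p, T.Edge p v
  · obtain ⟨p, hp⟩ := h
    refine (T.locally_finite p).subset ?_
    rintro w ⟨q, hq, hw⟩
    rwa [T.parent_unique _ _ _ hq hp] at hw
  · refine Set.finite_empty.subset ?_
    rintro w ⟨q, hq, _⟩
    exact h ⟨q, hq⟩

end RootedTree

/-! ### Directed Cartesian products -/

variable {d : ℕ} {V : Fin d → Type*} (T : ∀ j, RootedTree (V j))

/-- The root of the directed Cartesian product. -/
def root : ∀ j, V j := fun j => (T j).root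

/-- The depth `𝖽_v ∈ ℕ^d` of a vertex of the directed Cartesian product. -/
def depth (v : ∀ j, V j) : Fin d → ℕ := fun j => (T j).depth (v j)

/-- `|𝖽_v|`. -/
def totalDepth (v : ∀ j, V j) : ℕ := ∑ j, depth T v j

/-- The children of `v` in the `j`-th direction. -/
def childi (j : Fin d) (v : ∀ j, V j) : Set (∀ j, V j) :=
  Function.update v j '' (T j).children (v j)

/-- The parent of `v` in the `j`-th direction. -/
def parenti (j : Fin d) (v : ∀ j, V j) : ∀ j, V j :=
  Function.update v j ((T j).parent (v j))

/-- The siblings of `v` in the `j`-th direction. -/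
def sibi (j : Fin d) (v : ∀ j, V j) : Set (∀ j, V j) :=
  Function.update v j '' (T j).sib (v j)

/-- `Φ_F`: the vertices whose coordinates different from the root are exactly those in `F`. -/
def Phi (F : Finset (Fin d)) : Set (∀ j, V j) :=
  {v | (∀ j ∈ F, v j ≠ (T j).root) ∧ ∀ j ∉ F, v j = (T j).root}

/-- `sib_F(u)`: the vertices obtained from `u` by passing to siblings in all directions in `F`. -/
def sibF (F : Finset (Fin d)) (u : ∀ j, V j) : Set (∀ j, V j) :=
  {w | (∀ j ∈ F, w j ∈ (T j).sib (u j)) ∧ ∀ j ∉ F, w j = u j}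

/-- `Ω` is an indexing set corresponding to `F`: it consists of exactly one element from each of
the classes `sib_F(u)`, `u ∈ Φ_F`. -/
def IsIndexingSet (F : Finset (Fin d)) (Ω : Set (∀ j, V j)) : Prop :=
  Ω ⊆ Phi T F ∧ ∀ v ∈ Phi T F, ∃! u, u ∈ Ω ∧ v ∈ sibF T F u

/-- `v_G`: the vertex with the coordinates of `v` in `G` and the roots elsewhere. -/
def restr (G : Finset (Fin d)) (v : ∀ j, V j) : ∀ j, V j :=
  fun j => if j ∈ G then v j else (T j).root

/-- The directed Cartesian product is of finite joint branching index. -/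
def FiniteJointBranchingIndex : Prop := ∀ j, (T j).branchingIndex ≠ ⊤

/-! ### Drury-Arveson-type multishifts -/

/-- The sequence `𝔠_a(t) = (t + d) / (t + a)`. -/
def daSeq (a d : ℕ) (t : ℕ) : ℝ := ((t : ℝ) + d) / ((t : ℝ) + a)

/-- The weights `λ_j(w)` of the Drury-Arveson-type multishift: if `w ∈ Chi_j(v)` then
`λ_j(w) = √(𝔠_a(|𝖽_v|) / card Chi_j(v)) * √((𝖽_{v_j} + 1) / (|𝖽_v| + d))`. Here `v` is the parent of
`w` in the `j`-th direction; the value is relevant only if `w_j` is not the root. -/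
def weight (a : ℕ) (j : Fin d) (w : ∀ j, V j) : ℝ :=
  √(daSeq a d (totalDepth T (parenti T j w)) / (childi T j (parenti T j w)).ncard) *
    √(((depth T (parenti T j w) j : ℝ) + 1) / ((totalDepth T (parenti T j w) : ℝ) + d))

/-- The complex Hilbert space `ℓ²(V)`, `V` being the vertex set of the product. -/
abbrev L2 (V : Fin d → Type*) : Type _ := lp (fun _ : (∀ j, V j) => ℂ) 2

open Classical in
/-- The mapping `Λ^{(j)}` on complex functions on the vertices of the product. -/
def shiftFun (a : ℕ) (j : Fin d) (f : (∀ j, V j) → ℂ) (v : ∀ j, V j) : ℂ :=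
  if v j = (T j).root then 0 else (weight T a j v : ℂ) * f (parenti T j v)

lemma childi_finite (j : Fin d) (v : ∀ j, V j) : (childi T j v).Finite :=
  ((T j).locally_finite (v j)).image _

lemma sibi_finite (j : Fin d) (v : ∀ j, V j) : (sibi T j v).Finite :=
  (RootedTree.finite_sib (v j)).image _

lemma mem_childi_parenti {j : Fin d} {v : ∀ j, V j} (h : v j ≠ (T j).root) :
    v ∈ childi T j (parenti T j v) := by
  refine ⟨v j, ?_, ?_⟩
  · simpa [parenti, RootedTree.children] using RootedTree.edge_parent h
  · simp [parenti]

lemma daSeq_nonneg (a d t : ℕ) : 0 ≤ daSeq a d t := by unfold daSeq; positivity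

lemma daSeq_le (a d t : ℕ) : daSeq a d t ≤ 1 + d := by
  unfold daSeq
  rcases Nat.eq_zero_or_pos (t + a) with h | h
  · have : ((t : ℝ) + a) = 0 := by exact_mod_cast h
    rw [this, div_zero]
    positivity
  · have h1 : (1 : ℝ) ≤ (t : ℝ) + a := by exact_mod_cast h
    rw [div_le_iff₀ (by linarith)]
    have ha : (0 : ℝ) ≤ a := by positivity
    have hd : (0 : ℝ) ≤ d := by positivity
    nlinarith

lemma weight_sq_le (a : ℕ) (j : Fin d) (w : ∀ j, V j) :
    weight T a j w ^ 2 ≤ (1 + d : ℝ) / (childi T j (parenti T j w)).ncard := by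
  set v := parenti T j w
  have h1 : (0 : ℝ) ≤ daSeq a d (totalDepth T v) / (childi T j v).ncard :=
    div_nonneg (daSeq_nonneg _ _ _) (Nat.cast_nonneg _)
  have h2 : ((depth T v j : ℝ) + 1) / ((totalDepth T v : ℝ) + d) ≤ 1 := by
    apply div_le_one_of_le₀ _ (by positivity)
    have h3 : depth T v j ≤ totalDepth T v :=
      Finset.single_le_sum (f := depth T v) (fun _ _ => Nat.zero_le _) (Finset.mem_univ j)
    have h4 : 1 ≤ d := Fin.pos j
    exact_mod_cast Nat.add_le_add h3 h4
  have h3 : (0 : ℝ) ≤ ((depth T v j : ℝ) + 1) / ((totalDepth T v : ℝ) + d) := by positivity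
  rw [weight, mul_pow, Real.sq_sqrt h1, Real.sq_sqrt h3]
  calc _ ≤ daSeq a d (totalDepth T v) / (childi T j v).ncard * 1 :=
        mul_le_mul_of_nonneg_left h2 h1
    _ ≤ _ := by
        rw [mul_one]
        exact div_le_div_of_nonneg_right (daSeq_le _ _ _) (Nat.cast_nonneg _)

lemma sum_shiftFun_le (a : ℕ) (j : Fin d) (f : L2 V) (s : Finset (∀ j, V j)) :
    ∑ v ∈ s, ‖shiftFun T a j f v‖ ^ 2 ≤ (1 + d : ℝ) * ‖f‖ ^ 2 := by
  classical
  have hfib : ∑ v ∈ s, ‖shiftFun T a j f v‖ ^ 2 =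
      ∑ u ∈ s.image (parenti T j), ∑ v ∈ s with parenti T j v = u,
        ‖shiftFun T a j f v‖ ^ 2 :=
    (Finset.sum_fiberwise_of_maps_to (fun v hv => Finset.mem_image_of_mem _ hv) _).symm
  rw [hfib]
  have hone : ∀ u, ∑ v ∈ s with parenti T j v = u, ‖shiftFun T a j f v‖ ^ 2 ≤
      (1 + d : ℝ) * ‖f u‖ ^ 2 := by
    intro u
    have hle : ∀ v ∈ s.filter (fun v => parenti T j v = u), ‖shiftFun T a j f v‖ ^ 2 ≤
        if v j = (T j).root then 0 else (1 + d : ℝ) / (childi T j u).ncard * ‖f u‖ ^ 2 := by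
      intro v hv
      have hvu : parenti T j v = u := (Finset.mem_filter.1 hv).2
      unfold shiftFun
      split_ifs with h
      · simp
      · rw [norm_mul, mul_pow, hvu]
        refine mul_le_mul_of_nonneg_right ?_ (by positivity)
        have := weight_sq_le T a j v
        rw [hvu] at this
        simpa using this
    refine (Finset.sum_le_sum hle).trans ?_
    rw [Finset.sum_ite, Finset.sum_const_zero, zero_add, Finset.sum_const, nsmul_eq_mul,
      ← mul_assoc]
    refine mul_le_mul_of_nonneg_right ?_ (by positivity)
    set t := Finset.filter (fun v => ¬ v j = (T j).root) (s.filter (fun v => parenti T j v = u))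
    have hsub : (t : Set (∀ j, V j)) ⊆ childi T j u := by
      intro v hv
      have hv' := Finset.mem_filter.1 (Finset.mem_coe.1 hv)
      have hvu : parenti T j v = u := (Finset.mem_filter.1 hv'.1).2
      exact hvu ▸ mem_childi_parenti T hv'.2
    have hcard : t.card ≤ (childi T j u).ncard := by
      rw [← Set.ncard_coe_finset]
      exact Set.ncard_le_ncard hsub (childi_finite T j u)
    rcases Nat.eq_zero_or_pos (childi T j u).ncard with h0 | h0
    · rw [h0]
      simp only [Nat.cast_zero, div_zero, mul_zero]
      positivity
    · have h0' : (0 : ℝ) < (childi T j u).ncard := by exact_mod_cast h0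
      rw [mul_div_assoc', div_le_iff₀ h0', mul_comm]
      exact mul_le_mul_of_nonneg_left (by exact_mod_cast hcard) (by positivity)
  refine (Finset.sum_le_sum fun u _ => hone u).trans ?_
  rw [← Finset.mul_sum]
  refine mul_le_mul_of_nonneg_left ?_ (by positivity)
  have := lp.sum_rpow_le_norm_rpow (p := 2) (by norm_num) f (s.image (parenti T j))
  simpa using this

/-- The `j`-th component `S_j` of the Drury-Arveson-type multishift on `ℓ²(V)`. -/
def multishift (a : ℕ) (j : Fin d) : L2 V →L[ℂ] L2 V :=
  LinearMap.mkContinuous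
    { toFun := fun f => ⟨shiftFun T a j f, memℓp_gen' (C := (1 + d : ℝ) * ‖f‖ ^ 2) (by
        intro s
        simpa using sum_shiftFun_le T a j f s)⟩
      map_add' := by
        intro f g
        ext v
        simp only [shiftFun, lp.coeFn_add, Pi.add_apply]
        split_ifs <;> simp [mul_add]
      map_smul' := by
        intro c f
        ext v
        simp only [shiftFun, lp.coeFn_smul, Pi.smul_apply, RingHom.id_apply, smul_eq_mul]
        split_ifs
        · simp
        · ring }
    (√(1 + d : ℝ)) (by
      intro f
      refine lp.norm_le_of_forall_sum_le (p := 2) (by norm_num) (by positivity) ?_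
      intro s
      have h := sum_shiftFun_le T a j f s
      have hsq : (√(1 + d : ℝ) * ‖f‖) ^ 2 = (1 + d : ℝ) * ‖f‖ ^ 2 := by
        rw [mul_pow, Real.sq_sqrt (by positivity)]
      simpa [hsq] using h)

@[simp]
lemma multishift_apply (a : ℕ) (j : Fin d) (f : L2 V) (v : ∀ j, V j) :
    multishift T a j f v = shiftFun T a j f v := rfl

/-- The joint kernel `E = ⋂_j ker S_j^*` of the adjoint of the multishift. -/
def jointKernel (a : ℕ) : Submodule ℂ (L2 V) :=
  ⨅ j, LinearMap.ker (ContinuousLinearMap.adjoint (multishift T a j)).toLinearMap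

instance (a : ℕ) : CompleteSpace (jointKernel T a) := by
  have h : IsClosed (jointKernel T a : Set (L2 V)) := by
    rw [jointKernel, Submodule.coe_iInf]
    exact isClosed_iInter fun j => ContinuousLinearMap.isClosed_ker _
  exact h.completeSpace_coe

/-- `𝓛_{u,F} ⊆ ℓ²(sib_F(u))` (the latter regarded as a subspace of `ℓ²(V)`): the solution space of
the equations `∑_{w ∈ sib_j(v_G|u_j)} f(w) λ_j(w) = 0` for `j ∈ F`, `v_G ∈ sib_{F,G}(u)`, where
`G = F \ {j}`; here `v_G|u_j` is `v_G` with the `j`-th coordinate replaced by `u_j`. All these sums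
are finite. -/
def solutionSpace (a : ℕ) (F : Finset (Fin d)) (u : ∀ j, V j) : Submodule ℂ (L2 V) where
  carrier := {f | (∀ v, v ∉ sibF T F u → f v = 0) ∧
    ∀ j ∈ F, ∀ v ∈ sibF T F u,
      ∑ᶠ w ∈ sibi T j (Function.update (restr T (F.erase j) v) j (u j)),
        f w * (weight T a j w : ℂ) = 0}
  zero_mem' := by
    refine ⟨fun v _ => rfl, fun j _ v _ => ?_⟩
    simp
  add_mem' := by
    rintro f g ⟨hf, hf'⟩ ⟨hg, hg'⟩
    refine ⟨fun v hv => by simp [hf v hv, hg v hv], fun j hj v hv => ?_⟩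
    simp only [lp.coeFn_add, Pi.add_apply, add_mul]
    rw [finsum_mem_add_distrib (sibi_finite T _ _), hf' j hj v hv, hg' j hj v hv, add_zero]
  smul_mem' := by
    rintro c f ⟨hf, hf'⟩
    refine ⟨fun v hv => by simp [hf v hv], fun j hj v hv => ?_⟩
    simp only [lp.coeFn_smul, Pi.smul_apply, smul_eq_mul, mul_assoc]
    refine (mul_finsum_mem (fun w => f w * (weight T a j w : ℂ)) c).symm.trans ?_
    rw [hf' j hj v hv, mul_zero]

lemma isClosed_solutionSpace (a : ℕ) (F : Finset (Fin d)) (u : ∀ j, V j) :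
    IsClosed (solutionSpace T a F u : Set (L2 V)) := by
  have hev : ∀ v : (∀ j, V j), Continuous fun f : L2 V => f v := fun v =>
    (continuous_apply v).comp (lp.uniformContinuous_coe (p := 2)).continuous
  have : (solutionSpace T a F u : Set (L2 V)) =
      (⋂ v, ⋂ (_ : v ∉ sibF T F u), {f : L2 V | f v = 0}) ∩
      ⋂ j, ⋂ (_ : j ∈ F), ⋂ v, ⋂ (_ : v ∈ sibF T F u),
        {f : L2 V | ∑ᶠ w ∈ sibi T j (Function.update (restr T (F.erase j) v) j (u j)),
          f w * (weight T a j w : ℂ) = 0} := by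
    ext f
    simp [solutionSpace]
  rw [this]
  refine IsClosed.inter (isClosed_iInter fun v => isClosed_iInter fun _ =>
    isClosed_eq (hev v) continuous_const) ?_
  refine isClosed_iInter fun j => isClosed_iInter fun _ => isClosed_iInter fun v =>
    isClosed_iInter fun _ => isClosed_eq ?_ continuous_const
  have hfin := sibi_finite T j (Function.update (restr T (F.erase j) v) j (u j))
  simp_rw [finsum_mem_eq_finite_toFinset_sum _ hfin]
  exact continuous_finsetSum _ fun w _ => (hev w).mul continuous_const

/-- `𝓛_{u,F}` as a subspace of `E`. -/
def solutionSpaceE (a : ℕ) (F : Finset (Fin d)) (u : ∀ j, V j) :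
    Submodule ℂ (jointKernel T a) :=
  (solutionSpace T a F u).comap (jointKernel T a).subtype

instance (a : ℕ) (F : Finset (Fin d)) (u : ∀ j, V j) :
    CompleteSpace (solutionSpaceE T a F u) := by
  have h : IsClosed (solutionSpaceE T a F u : Set (jointKernel T a)) :=
    (isClosed_solutionSpace T a F u).preimage continuous_subtype_val
  exact h.completeSpace_coe

/-! ### The Drury-Arveson-type Hilbert module -/

/-- The open unit ball `𝔹^d` of `ℂ^d`. -/
abbrev Ball (d : ℕ) : Type := Metric.ball (0 : EuclideanSpace ℂ (Fin d)) 1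

/-- The coefficient `(δ! / (δ + α)!) * ∏_{j=0}^{|α|-1} (|δ| + a + j)`. -/
def kernelCoeff (a : ℕ) (δ α : Fin d → ℕ) : ℝ :=
  (∏ j, ((δ j)! : ℝ)) / (∏ j, ((δ j + α j)! : ℝ)) *
    ∏ i ∈ Finset.range (∑ j, α j), ((∑ j, (δ j : ℝ)) + a + i)

/-- The monomial `z^α`. -/
def monomial (α : Fin d → ℕ) (z : Ball d) : ℂ := ∏ j, (z : EuclideanSpace ℂ (Fin d)) j ^ α j

/-- The scalar kernel `∑_α (δ! / (δ + α)!) (∏_{j=0}^{|α|-1} (|δ| + a + j)) z^α w̄^α`. -/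
def scalarKernel (a : ℕ) (δ : Fin d → ℕ) (z w : Ball d) : ℂ :=
  ∑' α : Fin d → ℕ, (kernelCoeff a δ α : ℂ) * monomial α z * conj (monomial α w)

/-- The summand of the reproducing kernel that corresponds to `F` and `u`: the scalar kernel with
`δ = 𝖽_u` times the orthogonal projection of `E` onto `𝓛_{u,F}`. -/
def blockKernel (a : ℕ) (F : Finset (Fin d)) (u : ∀ j, V j) :
    Matrix (Ball d) (Ball d) (jointKernel T a →L[ℂ] jointKernel T a) :=
  fun z w => scalarKernel a (depth T u) z w • (solutionSpaceE T a F u).starProjection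

/-- The reproducing kernel
`κ(z, w) = ∑_F ∑_{u ∈ Ω_F} (∑_α (𝖽_u! / (𝖽_u + α)!) (∏_{j=0}^{|α|-1} (|𝖽_u| + a + j)) z^α w̄^α) P_{𝓛_{u,F}}`.
If the product is of finite joint branching index then only finitely many of the summands over
`u` are nonzero. -/
def daKernel (a : ℕ) (Ω : Finset (Fin d) → Set (∀ j, V j)) :
    Matrix (Ball d) (Ball d) (jointKernel T a →L[ℂ] jointKernel T a) :=
  ∑ F : Finset (Fin d), ∑ᶠ u ∈ Ω F, blockKernel T a F u

lemma kernelCoeff_nonneg (a : ℕ) (δ α : Fin d → ℕ) : 0 ≤ kernelCoeff a δ α := by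
  unfold kernelCoeff; positivity

lemma sum_kernelCoeff_le (a : ℕ) (δ : Fin d → ℕ) (x : Fin d → ℝ) (hx : ∀ j, 0 ≤ x j)
    (n : ℕ) : ∑ α ∈ Finset.univ.piAntidiag n, kernelCoeff a δ α * ∏ j, x j ^ α j ≤
      ((n + (∑ j, δ j + a)).choose (∑ j, δ j + a) : ℝ) * (∑ j, x j) ^ n := by
  set m := ∑ j, δ j + a with hm
  rw [Finset.sum_pow_eq_sum_piAntidiag, Finset.mul_sum]
  refine Finset.sum_le_sum fun α hα => ?_
  have hα' : ∑ j, α j = n := (Finset.mem_piAntidiag.1 hα).1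
  rw [← mul_assoc]
  refine mul_le_mul_of_nonneg_right ?_ (Finset.prod_nonneg fun j _ => pow_nonneg (hx j) _)
  have hasc : (∏ i ∈ Finset.range (∑ j, α j), ((∑ j, (δ j : ℝ)) + a + i)) ≤
      (n ! : ℝ) * ((n + m).choose m : ℝ) := by
    have h1 : (m + 1).ascFactorial n = n ! * (m + n).choose n :=
      Nat.ascFactorial_eq_factorial_mul_choose m n
    rw [show (n + m).choose m = (m + n).choose n by
      rw [add_comm n m, Nat.choose_symm_add], ← Nat.cast_mul, ← h1,
      Nat.ascFactorial_eq_prod_range, hα', Nat.cast_prod]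
    refine Finset.prod_le_prod (fun i _ => by positivity) fun i _ => ?_
    rw [hm]
    push_cast
    linarith
  have hmult : (n ! : ℝ) = (∏ j, ((α j)! : ℝ)) * (Nat.multinomial Finset.univ α : ℝ) := by
    have := Nat.multinomial_spec Finset.univ α
    rw [hα'] at this
    exact_mod_cast this.symm
  have hpos : (0 : ℝ) < ∏ j, ((α j)! : ℝ) := Finset.prod_pos fun j _ => by positivity
  have hpos' : (0 : ℝ) < ∏ j, ((δ j + α j)! : ℝ) := Finset.prod_pos fun j _ => by positivity
  have hfrac : (∏ j, ((δ j)! : ℝ)) / (∏ j, ((δ j + α j)! : ℝ)) ≤ 1 / ∏ j, ((α j)! : ℝ) := by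
    rw [div_le_div_iff₀ hpos' hpos, one_mul, ← Finset.prod_mul_distrib]
    refine Finset.prod_le_prod (fun i _ => by positivity) fun i _ => ?_
    exact_mod_cast Nat.le_of_dvd (Nat.factorial_pos _) (Nat.factorial_mul_factorial_dvd_factorial_add (δ i) (α i))
  calc kernelCoeff a δ α ≤ 1 / (∏ j, ((α j)! : ℝ)) * ((n ! : ℝ) * ((n + m).choose m : ℝ)) := by
        unfold kernelCoeff
        exact mul_le_mul hfrac hasc (Finset.prod_nonneg fun i _ => by positivity) (by positivity)
    _ = _ := by
        rw [hmult]
        field_simp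

lemma summable_kernelCoeff (a : ℕ) (δ : Fin d → ℕ) (x : Fin d → ℝ) (hx : ∀ j, 0 ≤ x j)
    (hx1 : ∑ j, x j < 1) : Summable fun α : Fin d → ℕ => kernelCoeff a δ α * ∏ j, x j ^ α j := by
  classical
  set m := ∑ j, δ j + a with hm
  have hr : ‖∑ j, x j‖ < 1 := by
    rwa [Real.norm_of_nonneg (Finset.sum_nonneg fun j _ => hx j)]
  have hS := summable_choose_mul_geometric_of_norm_lt_one m hr
  have h0 : ∀ α : Fin d → ℕ, 0 ≤ kernelCoeff a δ α * ∏ j, x j ^ α j := fun α =>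
    mul_nonneg (kernelCoeff_nonneg _ _ _) (Finset.prod_nonneg fun j _ => pow_nonneg (hx j) _)
  refine summable_of_sum_le (c := ∑' n : ℕ, ((n + m).choose m : ℝ) * (∑ j, x j) ^ n) h0 ?_
  intro s
  rw [← Finset.sum_fiberwise_of_maps_to (g := fun α : Fin d → ℕ => ∑ j, α j)
    (t := s.image fun α => ∑ j, α j) (fun α hα => Finset.mem_image_of_mem _ hα)]
  refine (Finset.sum_le_sum fun n _ => ?_).trans (hS.sum_le_tsum _ fun n _ =>
    mul_nonneg (Nat.cast_nonneg _) (pow_nonneg (Finset.sum_nonneg fun j _ => hx j) _))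
  refine le_trans ?_ (sum_kernelCoeff_le a δ x hx n)
  refine Finset.sum_le_sum_of_subset_of_nonneg ?_ fun α _ _ => h0 α
  intro α hα
  rw [Finset.mem_piAntidiag]
  exact ⟨(Finset.mem_filter.1 hα).2, fun i _ => Finset.mem_univ i⟩

/-- The series defining the scalar kernel converges absolutely on the unit ball. -/
lemma summable_scalarKernel (a : ℕ) (δ : Fin d → ℕ) (z w : Ball d) :
    Summable fun α : Fin d → ℕ =>
      (kernelCoeff a δ α : ℂ) * monomial α z * conj (monomial α w) := by
  have hz : ∀ z : Ball d, ∑ j, ‖(z : EuclideanSpace ℂ (Fin d)) j‖ ^ 2 < 1 := by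
    intro z
    have h : ‖(z : EuclideanSpace ℂ (Fin d))‖ < 1 := mem_ball_zero_iff.1 z.2
    have h2 := EuclideanSpace.norm_sq_eq (z : EuclideanSpace ℂ (Fin d))
    rw [← h2]
    exact pow_lt_one₀ (norm_nonneg _) h two_ne_zero
  have hlt : ∑ j, ‖(z : EuclideanSpace ℂ (Fin d)) j‖ * ‖(w : EuclideanSpace ℂ (Fin d)) j‖ < 1 := by
    have : ∑ j, ‖(z : EuclideanSpace ℂ (Fin d)) j‖ * ‖(w : EuclideanSpace ℂ (Fin d)) j‖ ≤
        (∑ j, ‖(z : EuclideanSpace ℂ (Fin d)) j‖ ^ 2 +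
          ∑ j, ‖(w : EuclideanSpace ℂ (Fin d)) j‖ ^ 2) / 2 := by
      rw [← Finset.sum_add_distrib, Finset.sum_div]
      refine Finset.sum_le_sum fun j _ => ?_
      nlinarith [sq_nonneg (‖(z : EuclideanSpace ℂ (Fin d)) j‖ -
        ‖(w : EuclideanSpace ℂ (Fin d)) j‖)]
    linarith [hz z, hz w]
  refine Summable.of_norm ((summable_kernelCoeff a δ _ (fun j => by positivity) hlt).congr ?_)
  intro α
  rw [norm_mul, norm_mul, RCLike.norm_conj, monomial, monomial, norm_prod, norm_prod, mul_assoc,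
    ← Finset.prod_mul_distrib, Complex.norm_real, Real.norm_of_nonneg (kernelCoeff_nonneg _ _ _)]
  simp [mul_pow]

lemma conj_scalarKernel (a : ℕ) (δ : Fin d → ℕ) (z w : Ball d) :
    conj (scalarKernel a δ z w) = scalarKernel a δ w z := by
  unfold scalarKernel
  rw [Complex.conj_tsum]
  refine tsum_congr fun α => ?_
  simp only [map_mul, Complex.conj_ofReal, Complex.conj_conj]
  ring

open scoped ComplexOrder in
lemma posSemidef_scalarKernel_smul {E : Type*} [NormedAddCommGroup E] [InnerProductSpace ℂ E]
    [CompleteSpace E] (L : Submodule ℂ E) [L.HasOrthogonalProjection] (a : ℕ) (δ : Fin d → ℕ) :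
    Matrix.PosSemidef (fun z w => scalarKernel a δ z w • L.starProjection :
      Matrix (Ball d) (Ball d) (E →L[ℂ] E)) := by
  set P := L.starProjection with hP
  have hsa : ∀ x y : E, ⟪P x, y⟫_ℂ = ⟪P x, P y⟫_ℂ := by
    intro x y
    have h1 := Submodule.inner_starProjection_left_eq_right L (P x) y
    have h2 : P (P x) = P x := by
      rw [hP]
      exact Submodule.starProjection_eq_self_iff.2 (Submodule.starProjection_apply_mem _ _)
    rw [← hP, h2] at h1
    exact h1
  refine (RKHS.posSemidef_tfae.out 0 2 rfl rfl).2 ⟨?_, ?_⟩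
  · ext z w : 1
    have hstar : star P = P := (isSelfAdjoint_starProjection L).star_eq
    change star (scalarKernel a δ w z • P) = scalarKernel a δ z w • P
    rw [star_smul, hstar]
    congr 1
    exact conj_scalarKernel _ _ _ _
  · intro f
    simp only [Finsupp.sum]
    have hterm : ∀ x y : Ball d, ⟪(scalarKernel a δ y x • P) (f x), f y⟫_ℂ =
        ∑' α : Fin d → ℕ, (kernelCoeff a δ α : ℂ) *
          ⟪conj (monomial α x) • P (f x), conj (monomial α y) • P (f y)⟫_ℂ := by
      intro x y
      rw [FunLike.coe_smul, Pi.smul_apply, inner_smul_left, conj_scalarKernel, hsa, scalarKernel, ← tsum_mul_right]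
      refine tsum_congr fun α => ?_
      rw [inner_smul_left, inner_smul_right, Complex.conj_conj]
      ring
    have hsum : ∀ x y : Ball d, Summable fun α : Fin d → ℕ =>
        (kernelCoeff a δ α : ℂ) *
          ⟪conj (monomial α x) • P (f x), conj (monomial α y) • P (f y)⟫_ℂ := by
      intro x y
      refine ((summable_scalarKernel a δ x y).mul_right
        ⟪P (f x), P (f y)⟫_ℂ).congr fun α => ?_
      rw [inner_smul_left, inner_smul_right, Complex.conj_conj]
      ring
    simp_rw [hterm]
    have hswap : (∑ x ∈ f.support, ∑ y ∈ f.support, ∑' α : Fin d → ℕ,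
        (kernelCoeff a δ α : ℂ) *
          ⟪conj (monomial α x) • P (f x), conj (monomial α y) • P (f y)⟫_ℂ) =
        ∑' α : Fin d → ℕ, ((kernelCoeff a δ α *
          ‖∑ x ∈ f.support, conj (monomial α x) • P (f x)‖ ^ 2 : ℝ) : ℂ) := by
      have h1 : ∀ x ∈ f.support, (∑ y ∈ f.support, ∑' α : Fin d → ℕ,
          (kernelCoeff a δ α : ℂ) *
            ⟪conj (monomial α x) • P (f x), conj (monomial α y) • P (f y)⟫_ℂ) =
          ∑' α : Fin d → ℕ, ∑ y ∈ f.support, (kernelCoeff a δ α : ℂ) *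
            ⟪conj (monomial α x) • P (f x), conj (monomial α y) • P (f y)⟫_ℂ := fun x _ =>
        (Summable.tsum_finsetSum fun y _ => hsum x y).symm
      rw [Finset.sum_congr rfl h1,
        ← Summable.tsum_finsetSum fun x _ => summable_sum fun y _ => hsum x y]
      refine tsum_congr fun α => ?_
      rw [Complex.ofReal_mul, Complex.ofReal_pow]
      have h2 := inner_self_eq_norm_sq_to_K (𝕜 := ℂ)
        (∑ x ∈ f.support, conj (monomial α x) • P (f x))
      simp only [Complex.coe_algebraMap] at h2
      rw [← h2, sum_inner, Finset.mul_sum]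
      refine Finset.sum_congr rfl fun x _ => ?_
      rw [inner_sum, Finset.mul_sum]
    rw [hswap, ← Complex.ofReal_tsum]
    change 0 ≤ (Complex.ofReal _).re
    rw [Complex.ofReal_re]
    exact tsum_nonneg fun α => mul_nonneg (kernelCoeff_nonneg _ _ _) (by positivity)

open scoped ComplexOrder in
lemma posSemidef_blockKernel (a : ℕ) (F : Finset (Fin d)) (u : ∀ j, V j) :
    (blockKernel T a F u).PosSemidef :=
  posSemidef_scalarKernel_smul (solutionSpaceE T a F u) a (depth T u)

open scoped ComplexOrder in
instance daKernel_posSemidef (a : ℕ) (Ω : Finset (Fin d) → Set (∀ j, V j)) :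
    Fact (daKernel T a Ω).PosSemidef := by
  refine ⟨?_⟩
  unfold daKernel
  refine Finset.sum_induction _ Matrix.PosSemidef (fun _ _ h h' => h.add h')
    Matrix.PosSemidef.zero fun F _ => ?_
  refine finsum_mem_induction Matrix.PosSemidef Matrix.PosSemidef.zero
    (fun _ _ h h' => h.add h') fun u _ => posSemidef_blockKernel T a F u

/-- The Drury-Arveson-type Hilbert module `ℋ_{𝔠_a}(𝒯)`: the reproducing kernel Hilbert space of
`E`-valued functions on the open unit ball with reproducing kernel `daKernel`. -/
def DAModule (a : ℕ) (Ω : Finset (Fin d) → Set (∀ j, V j)) : Type _ :=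
  RKHS.OfKernel (daKernel T a Ω)

variable (a : ℕ) (Ω : Finset (Fin d) → Set (∀ j, V j))

instance : NormedAddCommGroup (DAModule T a Ω) :=
  inferInstanceAs (NormedAddCommGroup (RKHS.OfKernel (daKernel T a Ω)))

instance : InnerProductSpace ℂ (DAModule T a Ω) :=
  inferInstanceAs (InnerProductSpace ℂ (RKHS.OfKernel (daKernel T a Ω)))

instance : CompleteSpace (DAModule T a Ω) :=
  inferInstanceAs (CompleteSpace (RKHS.OfKernel (daKernel T a Ω)))

instance : RKHS ℂ (DAModule T a Ω) (Ball d) (jointKernel T a) :=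
  inferInstanceAs (RKHS ℂ (RKHS.OfKernel (daKernel T a Ω)) (Ball d) (jointKernel T a))

lemma kernel_DAModule : RKHS.kernel (DAModule T a Ω) = daKernel T a Ω :=
  RKHS.OfKernel.kernel_ofKernel

variable {T a Ω} in
/-- The graph of the operator `ℳ_{z_k}` of multiplication by the coordinate function `z_k`:
`IsMul k f g` says that `ℳ_{z_k} f = g`. -/
def IsMul (k : Fin d) (f g : DAModule T a Ω) : Prop :=
  ∀ z : Ball d, g z = (z : EuclideanSpace ℂ (Fin d)) k • f z

/-- The Hilbert modules associated with two directed Cartesian products are isomorphic: there is a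
unitary map `U` with `U ℳ_{z_k} = ℳ_{z_k} U` for all `k`. The equality of operators is expressed
through graphs (`ℳ_{z_k} f = g` if and only if `ℳ_{z_k} U f = U g`), which is the intertwining
relation including the equality of domains. -/
def AreIsomorphic {W : Fin d → Type*} (a : ℕ) (T : ∀ j, RootedTree (V j))
    (Ω : Finset (Fin d) → Set (∀ j, V j)) (T' : ∀ j, RootedTree (W j))
    (Ω' : Finset (Fin d) → Set (∀ j, W j)) : Prop :=
  ∃ U : DAModule T a Ω ≃ₗᵢ[ℂ] DAModule T' a Ω',
    ∀ (k : Fin d) (f g : DAModule T a Ω), IsMul k f g ↔ IsMul k (U f) (U g)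

end DruryArveson

end

noncomputable section

namespace DruryArveson

open scoped InnerProductSpace ComplexConjugate Nat

section

/-! ### Unitaries from equal Gram matrices -/

/-! The reproducing kernel is block diagonal. The spaces `𝓛_{u,F}` are mutually orthogonal because
the sibling classes carrying them are disjoint, and only finitely many are nonzero because the
branching stops at a finite depth. Orthonormal bases of these spaces therefore split the module into
finitely many scalar modules (`exists_diagonalization`), one of type `δ = 𝖽_u` for each basis
vector. In a scalar module of type `δ` the monomials are orthogonal with `‖z^β‖² = 1 / kernelCoeff a
δ β`, so normalizing them turns multiplication by `z_k` into a weighted shift (`exists_model`).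

The number of summands of each type is a complete unitary invariant (`areIsomorphic_iff`). Equal
numbers give a unitary by matching summands. Conversely, an intertwining unitary preserves the
vectors orthogonal to the ranges of all the shifts, which are the constants. It also preserves the
factors `(δ_k + β_k + 1) / (|δ| + a + |β|)` by which the shifts scale squared norms. The factors at
`1` and at `z_k` determine `δ` unless `a = d = 1` (`eq_of_shiftRatio_eq`); in that excluded case
every factor is `1`. Hence constants of type `α` go to constants of type `α` (`map_single_apply`),
and the multiplicities agree (`card_eq_of_intertwining`).

What remains is counting. The depth `α` of a vertex of `Φ_F` has support exactly `F`, so the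
multiplicity of `α` involves a single `F`. The weights are constant on siblings and cancel from the
equations, which gives `dim 𝓛_{u,F} = ∏_{j ∈ F} (card sib(u_j) - 1)` (`finrank_solutionSpace`). A
sibling class is the same thing as its tuple of parents, so summing over the classes of depth `α`
factorizes into `∏_{j ∈ F} (card 𝒢_{α_j} - card 𝒢_{α_j - 1})` (`finsum_finrank_solutionSpace`). The
generation sizes thus determine all multiplicities; conversely, the case `F = {l}` gives their
successive differences, starting from `card 𝒢_0 = 1`. -/

lemma inner_linearCombination {ι H : Type*} [NormedAddCommGroup H] [InnerProductSpace ℂ H]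
    (x : ι → H) (c c' : ι →₀ ℂ) :
    ⟪Finsupp.linearCombination ℂ x c, Finsupp.linearCombination ℂ x c'⟫_ℂ =
      c.sum fun i s => c'.sum fun j t => conj s * (t * ⟪x i, x j⟫_ℂ) := by
  simp only [Finsupp.linearCombination_apply, Finsupp.sum_inner, Finsupp.inner_sum,
    inner_smul_left, inner_smul_right]
  rw [Finsupp.sum_comm]
  simp only [Finsupp.mul_sum]
  refine Finsupp.sum_congr fun i _ => Finsupp.sum_congr fun j _ => by ring

lemma denseRange_linearCombination {ι H : Type*} [NormedAddCommGroup H] [InnerProductSpace ℂ H]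
    [CompleteSpace H] (x : ι → H) (hx : ∀ f : H, (∀ i, ⟪x i, f⟫_ℂ = 0) → f = 0) :
    DenseRange (Finsupp.linearCombination ℂ x) := by
  have h : ((Submodule.span ℂ (Set.range x))ᗮ) = ⊥ := by
    refine (Submodule.eq_bot_iff _).2 fun f hf => hx f fun i => ?_
    exact hf _ (Submodule.subset_span ⟨i, rfl⟩)
  have h2 := Submodule.dense_iff_topologicalClosure_eq_top.2
    (Submodule.topologicalClosure_eq_top_iff.2 h)
  rwa [← Finsupp.range_linearCombination, LinearMap.coe_range] at h2

/-- Two total families in Hilbert spaces with the same Gram matrix are unitarily equivalent. -/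
lemma exists_unitary_of_gram {ι H K : Type*} [NormedAddCommGroup H] [InnerProductSpace ℂ H]
    [CompleteSpace H] [NormedAddCommGroup K] [InnerProductSpace ℂ K] [CompleteSpace K]
    (x : ι → H) (y : ι → K) (hgram : ∀ i j, ⟪x i, x j⟫_ℂ = ⟪y i, y j⟫_ℂ)
    (hx : ∀ f : H, (∀ i, ⟪x i, f⟫_ℂ = 0) → f = 0) (hy : ∀ f : K, (∀ i, ⟪y i, f⟫_ℂ = 0) → f = 0) :
    ∃ U : H ≃ₗᵢ[ℂ] K, ∀ i, U (x i) = y i := by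
  have hdx := denseRange_linearCombination x hx
  have hdy := denseRange_linearCombination y hy
  -- The norm of a linear combination depends only on its coefficients and the Gram matrix, so `x i
  -- ↦ y i` extends isometrically.
  have hnorm : ∀ c : ι →₀ ℂ, ‖Finsupp.linearCombination ℂ y (LinearEquiv.refl ℂ (ι →₀ ℂ) c)‖ =
      ‖Finsupp.linearCombination ℂ x c‖ := by
    intro c
    rw [@norm_eq_sqrt_re_inner ℂ, @norm_eq_sqrt_re_inner ℂ, inner_linearCombination]
    simp only [LinearEquiv.refl_apply, inner_linearCombination, hgram]
  refine ⟨(LinearEquiv.refl ℂ (ι →₀ ℂ)).extendOfIsometry _ _ hdx hdy hnorm,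
    fun i => ?_⟩
  have := LinearEquiv.extendOfIsometry_eq (LinearEquiv.refl ℂ (ι →₀ ℂ)) _ _ hdx hdy hnorm
    (Finsupp.single i 1)
  simpa using this

/-! ### Uniqueness of power series on the ball -/

variable {d : ℕ}

lemma smul_mem_ball {t : ℂ} (ht : ‖t‖ < 1) (x : Ball d) :
    t • (x : EuclideanSpace ℂ (Fin d)) ∈ Metric.ball (0 : EuclideanSpace ℂ (Fin d)) 1 := by
  have h : ‖(x : EuclideanSpace ℂ (Fin d))‖ < 1 := mem_ball_zero_iff.1 x.2
  rw [mem_ball_zero_iff, norm_smul]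
  exact mul_lt_one_of_nonneg_of_lt_one_left (norm_nonneg _) ht h.le

lemma prod_mul_pow_eq (t : ℂ) (x : Fin d → ℂ) (β : Fin d → ℕ) :
    ∏ j, (t * x j) ^ β j = t ^ (∑ j, β j) * ∏ j, x j ^ β j := by
  simp only [mul_pow, Finset.prod_mul_distrib, Finset.prod_pow_eq_pow_sum]

/-- Restricting to the disc `t ↦ t • x` collects the series into a one-variable power series in `t`,
whose `n`-th coefficient is the homogeneous part of degree `n` at `x`. -/
lemma homogeneous_part_eq_zero (c : (Fin d → ℕ) → ℂ)
    (hc : ∀ z : Ball d, HasSum (fun β => c β * monomial β z) 0) (x : Ball d) (n : ℕ) :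
    ∑ β ∈ Finset.univ.piAntidiag n, c β * monomial β x = 0 := by
  set p : ℕ → ℂ := fun n => ∑ β ∈ Finset.univ.piAntidiag n, c β * monomial β x with hp
  have hsum : ∀ t : ℂ, ‖t‖ < 1 → HasSum (fun n => t ^ n • p n) 0 := by
    intro t ht
    have h := (hc ⟨_, smul_mem_ball ht x⟩).tsum_fiberwise (fun β : Fin d → ℕ => ∑ j, β j)
    refine h.congr_fun ?_
    intro n
    have hset : (fun β : Fin d → ℕ => ∑ j, β j) ⁻¹' {n} =
        ((Finset.univ.piAntidiag n : Finset (Fin d → ℕ)) : Set (Fin d → ℕ)) := by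
      ext β
      simp
    rw [hset, Finset.tsum_subtype' (Finset.univ.piAntidiag n)
      (fun β => c β * monomial β ⟨_, smul_mem_ball ht x⟩), hp, smul_eq_mul, Finset.mul_sum]
    refine Finset.sum_congr rfl fun β hβ => ?_
    have hn : ∑ j, β j = n := (Finset.mem_piAntidiag.1 hβ).1
    simp only [monomial, PiLp.smul_apply, smul_eq_mul, prod_mul_pow_eq, hn]
    ring
  have hps : HasFPowerSeriesAt (0 : ℂ → ℂ) (FormalMultilinearSeries.ofScalars ℂ p) 0 := by
    rw [hasFPowerSeriesAt_iff]
    filter_upwards [Metric.ball_mem_nhds (0 : ℂ) one_pos] with t ht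
    simpa [FormalMultilinearSeries.coeff_ofScalars] using hsum t (mem_ball_zero_iff.1 ht)
  have h0 := hps.eq_zero
  have := congrArg (fun q : FormalMultilinearSeries ℂ ℂ ℂ => q.coeff n) h0
  exact FormalMultilinearSeries.coeff_ofScalars.symm.trans (this.trans rfl)

lemma exists_smul_ball (y : Fin d → ℂ) : ∃ (s : ℂ) (x : Ball d),
    ∀ j, y j = s * (x : EuclideanSpace ℂ (Fin d)) j := by
  set v : EuclideanSpace ℂ (Fin d) := WithLp.toLp 2 y
  have hpos : (0 : ℝ) < ‖v‖ + 1 := by positivity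
  have hne : ((‖v‖ + 1 : ℝ) : ℂ) ≠ 0 := by exact_mod_cast hpos.ne'
  refine ⟨((‖v‖ + 1 : ℝ) : ℂ), ⟨((‖v‖ + 1 : ℝ) : ℂ)⁻¹ • v, ?_⟩, fun j => ?_⟩
  · rw [mem_ball_zero_iff, norm_smul, norm_inv, Complex.norm_real, Real.norm_of_nonneg hpos.le,
      inv_mul_lt_iff₀ hpos]
    linarith
  · simp only [PiLp.smul_apply, smul_eq_mul]
    rw [mul_inv_cancel_left₀ hne]

/-- A power series that vanishes on the ball has vanishing coefficients. -/
lemma coeff_eq_zero_of_hasSum (c : (Fin d → ℕ) → ℂ)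
    (hc : ∀ z : Ball d, HasSum (fun β => c β * monomial β z) 0) : c = 0 := by
  classical
  funext α
  set n := ∑ j, α j with hn
  set P : MvPolynomial (Fin d) ℂ := ∑ β ∈ Finset.univ.piAntidiag n,
    MvPolynomial.monomial (Finsupp.equivFunOnFinite.symm β) (c β) with hP
  have hP0 : P = 0 := by
    -- The homogeneous part vanishes on the ball, hence by scaling at every point of `ℂ^d`, hence as
    -- a polynomial.
    refine MvPolynomial.funext fun y => ?_
    obtain ⟨s, x, hx⟩ := exists_smul_ball y
    rw [hP, map_sum, map_zero]
    have h := congrArg (fun r => s ^ n * r) (homogeneous_part_eq_zero c hc x n)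
    simp only [Finset.mul_sum, mul_zero] at h
    rw [← h]
    refine Finset.sum_congr rfl fun β hβ => ?_
    have hβn : ∑ j, β j = n := (Finset.mem_piAntidiag.1 hβ).1
    rw [MvPolynomial.eval_monomial, Finsupp.prod_fintype _ _ (by simp)]
    simp only [hx, Finsupp.equivFunOnFinite_symm_apply_apply, prod_mul_pow_eq, hβn, monomial]
    ring
  have h := congrArg (MvPolynomial.coeff (Finsupp.equivFunOnFinite.symm α)) hP0
  rw [hP, MvPolynomial.coeff_sum] at h
  simp only [MvPolynomial.coeff_monomial, EmbeddingLike.apply_eq_iff_eq, MvPolynomial.coeff_zero,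
    Finset.sum_ite_eq', Finset.mem_piAntidiag] at h
  simpa [hn] using h

end

section

/-! ### A sequence space model -/

variable {d : ℕ} {I : Type*}

/-- The Hilbert space of square summable families of Taylor coefficients. -/
abbrev ModelSpace (I : Type*) (d : ℕ) : Type _ := lp (fun _ : I × (Fin d → ℕ) => ℂ) 2

lemma kernelCoeff_pos {a : ℕ} (ha : 0 < a) (δ α : Fin d → ℕ) : 0 < kernelCoeff a δ α := by
  have : (0 : ℝ) < a := by exact_mod_cast ha
  unfold kernelCoeff
  positivity

open Classical in
/-- The coordinates in the model space of the kernel function at `z` in the direction `i`. -/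
def featureFun (a : ℕ) (δ : I → Fin d → ℕ) (z : Ball d) (i : I) (p : I × (Fin d → ℕ)) : ℂ :=
  if p.1 = i then (√(kernelCoeff a (δ i) p.2) : ℂ) * conj (monomial p.2 z) else 0

lemma norm_feature_sq (a : ℕ) (δ : Fin d → ℕ) (z : Ball d) (β : Fin d → ℕ) :
    ((‖(√(kernelCoeff a δ β) : ℂ) * conj (monomial β z)‖ ^ 2 : ℝ) : ℂ) =
      (kernelCoeff a δ β : ℂ) * monomial β z * conj (monomial β z) := by
  rw [norm_mul, mul_pow, Complex.norm_real, Real.norm_of_nonneg (Real.sqrt_nonneg _),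
    Real.sq_sqrt (kernelCoeff_nonneg _ _ _), RCLike.norm_conj, mul_assoc, Complex.mul_conj,
    Complex.normSq_eq_norm_sq]
  push_cast
  rfl

/-- Only the `i`-th copy contributes, and the squared moduli there sum to the scalar kernel at `(z,
z)`. -/
lemma memℓp_featureFun (a : ℕ) (δ : I → Fin d → ℕ) (z : Ball d) (i : I) :
    Memℓp (featureFun a δ z i) 2 := by
  refine memℓp_gen ?_
  have hinj : Function.Injective fun β : Fin d → ℕ => (i, β) := fun β γ h => (Prod.ext_iff.1 h).2
  refine (hinj.summable_iff ?_).1 ?_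
  · rintro ⟨j, β⟩ h
    have : j ≠ i := by
      rintro rfl
      exact h ⟨β, rfl⟩
    simp [featureFun, this]
  · have h := summable_scalarKernel a (δ i) z z
    simp_rw [← norm_feature_sq] at h
    simpa [Function.comp_def, featureFun] using Complex.summable_ofReal.1 h

/-- The element of the model space that corresponds to the kernel function at `z` in the
direction `i`. -/
def feature (a : ℕ) (δ : I → Fin d → ℕ) (z : Ball d) (i : I) : ModelSpace I d :=
  ⟨featureFun a δ z i, memℓp_featureFun a δ z i⟩

lemma feature_apply_same (a : ℕ) (δ : I → Fin d → ℕ) (z : Ball d) (i : I) (β : Fin d → ℕ) :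
    feature a δ z i (i, β) = (√(kernelCoeff a (δ i) β) : ℂ) * conj (monomial β z) :=
  if_pos rfl

lemma feature_apply_of_ne (a : ℕ) (δ : I → Fin d → ℕ) (z : Ball d) {i j : I} (h : j ≠ i)
    (β : Fin d → ℕ) : feature a δ z i (j, β) = 0 :=
  if_neg h

/-- The pairing with `feature a δ z i` evaluates the `i`-th power series at `z`. -/
lemma hasSum_inner_feature (a : ℕ) (δ : I → Fin d → ℕ) (z : Ball d) (i : I) (F : ModelSpace I d) :
    HasSum (fun β : Fin d → ℕ => ((√(kernelCoeff a (δ i) β) : ℂ) * F (i, β)) * monomial β z)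
      ⟪feature a δ z i, F⟫_ℂ := by
  have hinj : Function.Injective fun β : Fin d → ℕ => (i, β) := fun β γ h => (Prod.ext_iff.1 h).2
  have h := lp.hasSum_inner (𝕜 := ℂ) (feature a δ z i) F
  rw [← hinj.hasSum_iff] at h
  · refine h.congr_fun fun β => ?_
    simp only [Function.comp_apply, feature_apply_same, RCLike.inner_apply, map_mul,
      Complex.conj_ofReal, Complex.conj_conj]
    ring
  · rintro ⟨j, β⟩ h
    have hj : j ≠ i := by
      rintro rfl
      exact h ⟨β, rfl⟩
    rw [feature_apply_of_ne a δ z hj, inner_zero_left]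

lemma inner_feature_same (a : ℕ) (δ : I → Fin d → ℕ) (z w : Ball d) (i : I) :
    ⟪feature a δ z i, feature a δ w i⟫_ℂ = scalarKernel a (δ i) z w := by
  refine (hasSum_inner_feature a δ z i (feature a δ w i)).tsum_eq.symm.trans (tsum_congr fun β => ?_)
  rw [feature_apply_same, ← mul_assoc, ← Complex.ofReal_mul,
    Real.mul_self_sqrt (kernelCoeff_nonneg _ _ _)]
  ring

lemma inner_feature_of_ne (a : ℕ) (δ : I → Fin d → ℕ) (z w : Ball d) {i j : I} (h : i ≠ j) :
    ⟪feature a δ z i, feature a δ w j⟫_ℂ = 0 := by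
  refine (hasSum_inner_feature a δ z i (feature a δ w j)).tsum_eq.symm.trans ?_
  simp [feature_apply_of_ne a δ w h]

/-- The pairings are the values of power series whose coefficients are those of `F` times positive
constants, so uniqueness of power series applies. This makes the features a total family. -/
lemma eq_zero_of_inner_feature {a : ℕ} (ha : 0 < a) (δ : I → Fin d → ℕ) (F : ModelSpace I d)
    (h : ∀ z i, ⟪feature a δ z i, F⟫_ℂ = 0) : F = 0 := by
  ext ⟨i, β⟩
  have h0 := coeff_eq_zero_of_hasSum
    (fun β : Fin d → ℕ => (√(kernelCoeff a (δ i) β) : ℂ) * F (i, β)) fun z => by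
      simpa only [h z i] using hasSum_inner_feature a δ z i F
  have h1 := congrFun h0 β
  have hne : (√(kernelCoeff a (δ i) β) : ℂ) ≠ 0 := by
    exact_mod_cast (Real.sqrt_pos.2 (kernelCoeff_pos ha _ _)).ne'
  simpa [hne] using h1

/-- The graph of multiplication by the `k`-th coordinate function in the model space. -/
def ShiftRel (a : ℕ) (δ : I → Fin d → ℕ) (k : Fin d) (F G : ModelSpace I d) : Prop :=
  ∀ i γ, (√(kernelCoeff a (δ i) γ) : ℂ) * G (i, γ) =
    Function.extend (fun β : Fin d → ℕ => β + Pi.single k 1)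
      (fun β => (√(kernelCoeff a (δ i) β) : ℂ) * F (i, β)) 0 γ

lemma add_single_injective (k : Fin d) :
    Function.Injective fun β : Fin d → ℕ => β + Pi.single k 1 :=
  add_left_injective _

lemma monomial_add_single (k : Fin d) (β : Fin d → ℕ) (z : Ball d) :
    monomial (β + Pi.single k 1) z = (z : EuclideanSpace ℂ (Fin d)) k * monomial β z := by
  simp only [monomial, Pi.add_apply, pow_add, Finset.prod_mul_distrib]
  rw [mul_comm, Finset.prod_eq_single k]
  · simp
  · intro j _ hj
    simp [hj]
  · simp

/-- Multiplying the `i`-th power series by `z_k` shifts its coefficients, so the identity between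
values is an identity between coefficients by uniqueness of power series. -/
lemma shiftRel_iff (a : ℕ) (δ : I → Fin d → ℕ) (k : Fin d) (F G : ModelSpace I d) :
    ShiftRel a δ k F G ↔ ∀ z i, ⟪feature a δ z i, G⟫_ℂ =
      (z : EuclideanSpace ℂ (Fin d)) k * ⟪feature a δ z i, F⟫_ℂ := by
  have key : ∀ z i, HasSum (fun γ : Fin d → ℕ =>
      Function.extend (fun β : Fin d → ℕ => β + Pi.single k 1)
        (fun β => (√(kernelCoeff a (δ i) β) : ℂ) * F (i, β)) 0 γ * monomial γ z)
      ((z : EuclideanSpace ℂ (Fin d)) k * ⟪feature a δ z i, F⟫_ℂ) := by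
    intro z i
    refine ((add_single_injective k).hasSum_iff ?_).1 ?_
    · intro γ hγ
      rw [Function.extend_apply' _ _ _ (by simpa using hγ), Pi.zero_apply, zero_mul]
    · refine ((hasSum_inner_feature a δ z i F).mul_left _).congr_fun fun β => ?_
      rw [Function.comp_apply, (add_single_injective k).extend_apply, monomial_add_single]
      ring
  constructor
  · intro h z i
    refine HasSum.unique ((hasSum_inner_feature a δ z i G)) ?_
    simp_rw [h i]
    exact key z i
  · intro h i γ
    have h0 := coeff_eq_zero_of_hasSum (fun γ : Fin d → ℕ => (√(kernelCoeff a (δ i) γ) : ℂ) *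
      G (i, γ) - Function.extend (fun β : Fin d → ℕ => β + Pi.single k 1)
        (fun β => (√(kernelCoeff a (δ i) β) : ℂ) * F (i, β)) 0 γ) fun z => by
      have := (hasSum_inner_feature a δ z i G).sub (key z i)
      rw [h z i, sub_self] at this
      simpa only [sub_mul] using this
    exact sub_eq_zero.1 (congrFun h0 γ)

/-- A vector-valued reproducing kernel Hilbert space whose kernel is diagonal with respect to a
finite orthonormal family is unitarily equivalent to the model space, multiplication by the
coordinate functions corresponding to the shifts. -/
theorem exists_model [Fintype I] {E H : Type*} [NormedAddCommGroup E] [InnerProductSpace ℂ E]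
    [CompleteSpace E] [NormedAddCommGroup H] [InnerProductSpace ℂ H] [CompleteSpace H]
    [RKHS ℂ H (Ball d) E] {a : ℕ} (ha : 0 < a) (δ : I → Fin d → ℕ) (b : I → E)
    (hb : Orthonormal ℂ b)
    (hker : ∀ z w v, RKHS.kernel H z w v = ∑ i, scalarKernel a (δ i) z w • ⟪b i, v⟫_ℂ • b i) :
    ∃ U : H ≃ₗᵢ[ℂ] ModelSpace I d, ∀ (k : Fin d) (f g : H),
      (∀ z : Ball d, g z = (z : EuclideanSpace ℂ (Fin d)) k • f z) ↔
        ShiftRel a δ k (U f) (U g) := by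
  classical
  have hkb : ∀ z w j, RKHS.kernel H z w (b j) = scalarKernel a (δ j) z w • b j := by
    intro z w j
    rw [hker, Finset.sum_eq_single j]
    · rw [inner_self_eq_norm_sq_to_K, hb.1 j]
      simp
    · intro i _ hij
      rw [hb.2 hij, zero_smul, smul_zero]
    · simp
  -- The kernel annihilates such a `v`, so the kernel function at `z` in the direction `v` has norm
  -- zero.
  have hperp : ∀ (f : H) (z : Ball d) (v : E), (∀ i, ⟪b i, v⟫_ℂ = 0) → ⟪v, f z⟫_ℂ = 0 := by
    intro f z v hv
    have h0 : RKHS.kerFun H z v = 0 := by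
      rw [← inner_self_eq_zero (𝕜 := ℂ), ← RKHS.kernel_inner, hker]
      simp [hv]
    rw [← RKHS.kerFun_inner, h0, inner_zero_left]
  -- Consequently every function in `H` takes its values in the span of the finite family `b`.
  have hval : ∀ (f : H) (z : Ball d), f z = ∑ i, ⟪b i, f z⟫_ℂ • b i := by
    intro f z
    have hi : ∀ i, ⟪b i, f z - ∑ i, ⟪b i, f z⟫_ℂ • b i⟫_ℂ = 0 := by
      intro i
      rw [inner_sub_right, hb.inner_right_fintype, sub_self]
    have h1 := hperp f z _ hi
    refine sub_eq_zero.1 (inner_self_eq_zero (𝕜 := ℂ) |>.1 ?_)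
    rw [inner_sub_right, h1, inner_sum]
    refine (zero_sub _).trans (neg_eq_zero.2 (Finset.sum_eq_zero fun i _ => ?_))
    rw [inner_smul_right, inner_eq_zero_symm.1 (hi i), mul_zero]
  obtain ⟨U, hU⟩ := exists_unitary_of_gram
    (fun p : Ball d × I => RKHS.kerFun H p.1 (b p.2)) (fun p => feature a δ p.1 p.2)
    (by
      rintro ⟨z, i⟩ ⟨w, j⟩
      simp only
      rw [RKHS.kerFun_inner, RKHS.kerFun_apply, hkb, inner_smul_right]
      by_cases hij : i = j
      · subst hij
        rw [inner_feature_same, inner_self_eq_norm_sq_to_K, hb.1 i]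
        simp
      · rw [hb.2 hij, mul_zero, inner_feature_of_ne a δ z w hij])
    (by
      intro f hf
      refine RKHS.ext fun z => ?_
      rw [hval f z]
      have : ∀ i, ⟪b i, f z⟫_ℂ = 0 := fun i => by
        rw [← RKHS.kerFun_inner]
        exact hf (z, i)
      simp [this])
    (fun F hF => eq_zero_of_inner_feature ha δ F fun z i => hF (z, i))
  -- Pairing with a feature evaluates the `i`-th component at `z`, so multiplication by `z_k` can be
  -- read off on both sides.
  have hcoord : ∀ f z i, ⟪feature a δ z i, U f⟫_ℂ = ⟪b i, f z⟫_ℂ := by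
    intro f z i
    rw [← hU (z, i), LinearIsometryEquiv.inner_map_map, RKHS.kerFun_inner]
  refine ⟨U, fun k f g => ?_⟩
  rw [shiftRel_iff]
  constructor
  · intro h z i
    rw [hcoord, hcoord, h z, inner_smul_right]
  · intro h z
    rw [hval g z, hval f z, Finset.smul_sum]
    refine Finset.sum_congr rfl fun i _ => ?_
    rw [← hcoord, ← hcoord, h z i, smul_smul]

end

section

/-! ### Unitary invariants of the model space -/

variable {d : ℕ} {I J : Type*}

/-- The squared norm of multiplication by the `j`-th coordinate function at `z ^ β`. -/
def shiftRatio (a : ℕ) (δ : Fin d → ℕ) (j : Fin d) (β : Fin d → ℕ) : ℝ :=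
  kernelCoeff a δ β / kernelCoeff a δ (β + Pi.single j 1)

lemma prod_factorial_add_single (δ : Fin d → ℕ) (j : Fin d) :
    ∏ i, ((δ i + (Pi.single j 1 : Fin d → ℕ) i)! : ℝ) = (δ j + 1) * ∏ i, ((δ i)! : ℝ) := by
  rw [← Finset.mul_prod_erase _ _ (Finset.mem_univ j),
    ← Finset.mul_prod_erase _ (fun i => ((δ i)! : ℝ)) (Finset.mem_univ j), ← mul_assoc]
  congr 1
  · simp [Nat.factorial_succ]
  · refine Finset.prod_congr rfl fun i hi => ?_
    simp [(Finset.mem_erase.1 hi).1]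

/-- Raising `β_j` by one contributes one factor to the factorials in the denominator and one factor
to the rising product; everything else cancels. -/
lemma shiftRatio_eq {a : ℕ} (ha : 0 < a) (δ : Fin d → ℕ) (j : Fin d) (β : Fin d → ℕ) :
    shiftRatio a δ j β = ((δ j : ℝ) + β j + 1) / (∑ i, (δ i : ℝ) + a + ∑ i, (β i : ℝ)) := by
  have ha' : (0 : ℝ) < a := by exact_mod_cast ha
  have hsum : ∑ i, (β + Pi.single j 1 : Fin d → ℕ) i = ∑ i, β i + 1 := by
    simp [Finset.sum_add_distrib]
  have hfac := prod_factorial_add_single (δ + β) j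
  simp only [Pi.add_apply, add_assoc] at hfac
  unfold shiftRatio kernelCoeff
  rw [hsum, Finset.prod_range_succ]
  simp only [Pi.add_apply]
  rw [hfac]
  push_cast
  have h1 : ∏ i, ((δ i)! : ℝ) ≠ 0 := Finset.prod_ne_zero_iff.2 fun i _ => by positivity
  have h2 : ∏ i, ((δ i + β i)! : ℝ) ≠ 0 := Finset.prod_ne_zero_iff.2 fun i _ => by positivity
  have h3 : ∏ i ∈ Finset.range (∑ i, β i), (∑ i, (δ i : ℝ) + a + i) ≠ 0 :=
    Finset.prod_ne_zero_iff.2 fun i _ => by positivity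
  have h4 : ∑ i, (δ i : ℝ) + a + ∑ i, (β i : ℝ) ≠ 0 := by positivity
  have h5 : (δ j : ℝ) + β j + 1 ≠ 0 := by positivity
  field_simp

/-- The ratios at `1` and at the coordinate functions determine `δ`, unless `a * d = 1`. -/
lemma eq_of_shiftRatio_eq {a : ℕ} (ha : 0 < a) (had : a * d ≠ 1) (δ ε : Fin d → ℕ)
    (h0 : ∀ j, shiftRatio a δ j 0 = shiftRatio a ε j 0)
    (h1 : ∀ j, shiftRatio a δ j (0 + Pi.single j 1) = shiftRatio a ε j (0 + Pi.single j 1)) :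
    δ = ε := by
  have ha' : (1 : ℝ) ≤ a := by exact_mod_cast ha
  set s := ∑ i, (δ i : ℝ) + a with hs
  set t := ∑ i, (ε i : ℝ) + a with ht
  have hs0 : 0 < s := by positivity
  have ht0 : 0 < t := by positivity
  have e0 : ∀ j, ((δ j : ℝ) + 1) * t = (ε j + 1) * s := by
    intro j
    have h := h0 j
    rw [shiftRatio_eq ha, shiftRatio_eq ha, ← hs, ← ht] at h
    simp only [Pi.zero_apply, Nat.cast_zero, Finset.sum_const_zero, add_zero] at h
    rwa [div_eq_div_iff hs0.ne' ht0.ne'] at h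
  have e1 : ∀ j, ((δ j : ℝ) + 2) * (t + 1) = (ε j + 2) * (s + 1) := by
    intro j
    have h := h1 j
    have hsum : ∑ i, (((Pi.single j 1 : Fin d → ℕ) i : ℕ) : ℝ) = 1 := by
      rw [← Nat.cast_sum]
      simp
    rw [shiftRatio_eq ha, shiftRatio_eq ha, ← hs, ← ht] at h
    simp only [zero_add, hsum, Pi.single_eq_same, Nat.cast_one] at h
    rw [div_eq_div_iff (by positivity) (by positivity)] at h
    linarith
  -- Subtracting `e0` from `e1` gives `δ_j + t = ε_j + s`. If `s ≠ t`, substituting this back into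
  -- `e0` forces `δ_j + 1 = s` and `ε_j + 1 = t` for all `j`. Summing over `j` shows that `s` and
  -- `t` both solve `d (r - 1) + a = r`, which has two solutions only if `d = a = 1`.
  have hst : s = t := by
    by_contra hne
    have hδ : ∀ j, (δ j : ℝ) + 1 = s := by
      intro j
      have h : (t - s) * ((δ j : ℝ) + 1 - s) = 0 := by
        nlinarith [e0 j, e1 j]
      rcases mul_eq_zero.1 h with h | h
      · exact absurd (by linarith) hne
      · linarith
    have hε : ∀ j, (ε j : ℝ) + 1 = t := by
      intro j
      have h := e0 j
      rw [hδ j] at h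
      exact (mul_left_cancel₀ hs0.ne' (by linarith)).symm
    rcases Nat.lt_or_ge d 1 with hd | hd
    · obtain rfl : d = 0 := by omega
      exact hne (by simp [hs, ht])
    have j0 : Fin d := ⟨0, hd⟩
    have key : ∀ (η : Fin d → ℕ) (r : ℝ), r = ∑ i, (η i : ℝ) + a → (∀ j, (η j : ℝ) + 1 = r) →
        (d : ℝ) * (r - 1) + a = r := by
      intro η r hr hη
      have : ∑ i, (η i : ℝ) = d * (r - 1) := by
        rw [Finset.sum_congr rfl fun j _ => eq_sub_of_add_eq (hη j)]
        simp [mul_sub]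
      linarith
    have hks := key δ s hs hδ
    have hkt := key ε t ht hε
    have hd1 : (d : ℝ) = 1 := by
      have : ((d : ℝ) - 1) * (s - t) = 0 := by linarith
      rcases mul_eq_zero.1 this with h | h
      · linarith
      · exact absurd (by linarith) hne
    rw [hd1] at hks
    have ha1 : (a : ℝ) = 1 := by linarith
    have hd1' : d = 1 := by exact_mod_cast hd1
    have ha1' : a = 1 := by exact_mod_cast ha1
    exact had (by rw [hd1', ha1'])
  funext j
  have h := e0 j
  rw [← hst] at h
  have := mul_right_cancel₀ hs0.ne' h
  have h2 : (δ j : ℝ) = ε j := by linarith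
  exact_mod_cast h2

lemma shiftRatio_pos {a : ℕ} (ha : 0 < a) (δ : Fin d → ℕ) (j : Fin d) (β : Fin d → ℕ) :
    0 < shiftRatio a δ j β :=
  div_pos (kernelCoeff_pos ha _ _) (kernelCoeff_pos ha _ _)

/-- In the coordinates of normalized monomials, multiplication by `z_k` is a weighted shift with
weight the square root of `shiftRatio`. -/
lemma ShiftRel.apply_add {a : ℕ} (ha : 0 < a) {δ : I → Fin d → ℕ} {k : Fin d} {F G : ModelSpace I d}
    (h : ShiftRel a δ k F G) (i : I) (β : Fin d → ℕ) :
    G (i, β + Pi.single k 1) = (√(shiftRatio a (δ i) k β) : ℂ) * F (i, β) := by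
  have h1 := h i (β + Pi.single k 1)
  rw [(add_single_injective k).extend_apply] at h1
  have hne : (√(kernelCoeff a (δ i) (β + Pi.single k 1)) : ℂ) ≠ 0 := by
    exact_mod_cast (Real.sqrt_pos.2 (kernelCoeff_pos ha _ _)).ne'
  rw [shiftRatio, Real.sqrt_div (kernelCoeff_nonneg _ _ _), Complex.ofReal_div]
  field_simp
  rw [mul_comm, h1, mul_comm]

lemma ShiftRel.apply_of_not_mem {a : ℕ} (ha : 0 < a) {δ : I → Fin d → ℕ} {k : Fin d}
    {F G : ModelSpace I d} (h : ShiftRel a δ k F G) (i : I) {γ : Fin d → ℕ}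
    (hγ : ∀ β : Fin d → ℕ, β + Pi.single k 1 ≠ γ) : G (i, γ) = 0 := by
  have h1 := h i γ
  rw [Function.extend_apply' _ _ _ (by simpa using hγ), Pi.zero_apply] at h1
  have hne : (√(kernelCoeff a (δ i) γ) : ℂ) ≠ 0 := by
    exact_mod_cast (Real.sqrt_pos.2 (kernelCoeff_pos ha _ _)).ne'
  exact (mul_eq_zero.1 h1).resolve_left hne

/-- If the shift multiplies squared norms by `r` on the support of `F` then it scales inner products
with `F` by `r`. -/
lemma ShiftRel.inner_eq {a : ℕ} (ha : 0 < a) {δ : I → Fin d → ℕ} {k : Fin d}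
    {F G F' G' : ModelSpace I d} (h : ShiftRel a δ k F G) (h' : ShiftRel a δ k F' G') {r : ℝ}
    (hr : ∀ i β, F (i, β) ≠ 0 → shiftRatio a (δ i) k β = r) :
    ⟪G, G'⟫_ℂ = r * ⟪F, F'⟫_ℂ := by
  rw [lp.inner_eq_tsum, lp.inner_eq_tsum, ← tsum_mul_left]
  have hinj : Function.Injective fun p : I × (Fin d → ℕ) => (p.1, p.2 + Pi.single k 1) := by
    rintro ⟨i, β⟩ ⟨j, γ⟩ h
    simpa using h
  -- `G` vanishes off the range of the index shift, so the sum for `⟪G, G'⟫` can be reindexed over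
  -- it.
  rw [← hinj.tsum_eq]
  · refine tsum_congr ?_
    rintro ⟨i, β⟩
    simp only [h.apply_add ha, h'.apply_add ha, RCLike.inner_apply, map_mul, Complex.conj_ofReal]
    by_cases hF : F (i, β) = 0
    · simp [hF]
    · rw [← hr i β hF]
      have := Real.mul_self_sqrt (shiftRatio_pos ha (δ i) k β).le
      have h2 : (√(shiftRatio a (δ i) k β) : ℂ) * √(shiftRatio a (δ i) k β) =
          shiftRatio a (δ i) k β := by exact_mod_cast this
      rw [← h2]
      ring
  · rintro ⟨i, γ⟩ hne
    by_contra hγ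
    have h0 : G (i, γ) = 0 :=
      h.apply_of_not_mem ha i fun β hβ => hγ ⟨(i, β), by simp [hβ]⟩
    refine hne ?_
    change ⟪G (i, γ), G' (i, γ)⟫_ℂ = 0
    rw [h0, inner_zero_left]

lemma ShiftRel.inner_eq' {a : ℕ} (ha : 0 < a) {δ : I → Fin d → ℕ} {k : Fin d}
    {F G F' G' : ModelSpace I d} (h : ShiftRel a δ k F G) (h' : ShiftRel a δ k F' G') {r : ℝ}
    (hr : ∀ i β, F' (i, β) ≠ 0 → shiftRatio a (δ i) k β = r) :
    ⟪G, G'⟫_ℂ = r * ⟪F, F'⟫_ℂ := by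
  rw [← inner_conj_symm, h'.inner_eq ha h hr, map_mul, Complex.conj_ofReal, inner_conj_symm]

lemma eq_of_single_apply_ne_zero [DecidableEq I] {i j : I} {β γ : Fin d → ℕ} {c : ℂ}
    (h : (lp.single 2 (i, β) c : ModelSpace I d) (j, γ) ≠ 0) : j = i ∧ γ = β := by
  by_contra hp
  exact h (lp.single_apply_ne _ _ _ (by simpa using hp))

lemma shiftRel_single [DecidableEq I] {a : ℕ} (ha : 0 < a) (δ : I → Fin d → ℕ) (k : Fin d) (i : I)
    (β : Fin d → ℕ) (c : ℂ) :
    ShiftRel a δ k (lp.single 2 (i, β) c)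
      (lp.single 2 (i, β + Pi.single k 1) ((√(shiftRatio a (δ i) k β) : ℂ) * c)) := by
  intro j γ
  by_cases hγ : ∃ β' : Fin d → ℕ, β' + Pi.single k 1 = γ
  · obtain ⟨β', rfl⟩ := hγ
    rw [(add_single_injective k).extend_apply]
    by_cases hp : j = i ∧ β' = β
    · obtain ⟨rfl, rfl⟩ := hp
      rw [lp.single_apply_self, lp.single_apply_self, shiftRatio,
        Real.sqrt_div (kernelCoeff_nonneg _ _ _), Complex.ofReal_div]
      have hne : (√(kernelCoeff a (δ j) (β' + Pi.single k 1)) : ℂ) ≠ 0 := by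
        exact_mod_cast (Real.sqrt_pos.2 (kernelCoeff_pos ha _ _)).ne'
      field_simp
    · rw [lp.single_apply_ne, lp.single_apply_ne, mul_zero, mul_zero]
      · simpa using hp
      · simpa using hp
  · rw [Function.extend_apply' _ _ _ hγ, lp.single_apply_ne, mul_zero, Pi.zero_apply]
    rintro h
    exact hγ ⟨β, (Prod.ext_iff.1 h).2.symm⟩

/-- If `γ_k ≠ 0`, the basis vector at `(i, γ)` is a nonzero multiple of the `k`-th shift of the one
at `(i, γ - ε_k)`, so `f` is orthogonal to it. -/
lemma apply_eq_zero_of_wandering {a : ℕ} (ha : 0 < a) {δ : I → Fin d → ℕ} {f : ModelSpace I d}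
    (hf : ∀ k F G, ShiftRel a δ k F G → ⟪f, G⟫_ℂ = 0) (i : I) {γ : Fin d → ℕ} (hγ : γ ≠ 0) :
    f (i, γ) = 0 := by
  classical
  obtain ⟨k, hk⟩ := Function.ne_iff.1 hγ
  have hβ : γ - Pi.single k 1 + Pi.single k 1 = γ := by
    funext j
    rcases eq_or_ne j k with rfl | hj
    · have : γ j ≠ 0 := hk
      simp only [Pi.add_apply, Pi.sub_apply, Pi.single_eq_same]
      omega
    · simp [hj]
  have h := hf k _ _ (shiftRel_single ha δ k i (γ - Pi.single k 1) 1)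
  rw [hβ, lp.inner_single_right, RCLike.inner_apply, mul_one] at h
  have hne : (√(shiftRatio a (δ i) k (γ - Pi.single k 1)) : ℂ) ≠ 0 := by
    exact_mod_cast (Real.sqrt_pos.2 (shiftRatio_pos ha _ _ _)).ne'
  simpa [hne] using h

/-- A function divisible by `z_k` has no constant term. -/
lemma wandering_single [DecidableEq I] {a : ℕ} (ha : 0 < a) (δ : I → Fin d → ℕ) (i : I) (k : Fin d)
    (F G : ModelSpace I d) (h : ShiftRel a δ k F G) : ⟪lp.single 2 (i, 0) (1 : ℂ), G⟫_ℂ = 0 := by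
  rw [lp.inner_single_left, h.apply_of_not_mem ha i, inner_zero_right]
  intro β hβ
  simpa using congrFun hβ k

/-- A unitary intertwining the shifts maps constant vectors of type `α` to constant vectors of
type `α`. -/
lemma map_single_apply [DecidableEq I] [DecidableEq J] {a : ℕ} (ha : 0 < a) (had : a * d ≠ 1) {δ : I → Fin d → ℕ}
    {ε : J → Fin d → ℕ} (U : ModelSpace I d ≃ₗᵢ[ℂ] ModelSpace J d)
    (hU : ∀ k F G, ShiftRel a δ k F G ↔ ShiftRel a ε k (U F) (U G)) (i : I) (j : J)
    (γ : Fin d → ℕ) (hne : U (lp.single 2 (i, 0) 1) (j, γ) ≠ 0) : γ = 0 ∧ ε j = δ i := by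
  set f := U (lp.single 2 (i, 0) 1) with hf
  have hwand : ∀ k F G, ShiftRel a ε k F G → ⟪f, G⟫_ℂ = 0 := by
    intro k F G h
    obtain ⟨F', rfl⟩ := U.surjective F
    obtain ⟨G', rfl⟩ := U.surjective G
    rw [hf, LinearIsometryEquiv.inner_map_map]
    exact wandering_single ha δ i k F' G' ((hU k _ _).2 h)
  have hγ : γ = 0 := by
    by_contra hγ
    exact hne (apply_eq_zero_of_wandering ha hwand j hγ)
  refine ⟨hγ, ?_⟩
  subst hγ
  set e : ModelSpace J d := lp.single 2 (j, 0) 1 with he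
  have hfe : ⟪f, e⟫_ℂ ≠ 0 := by
    rw [he, lp.inner_single_right, RCLike.inner_apply]
    simpa using hne
  -- Shifting both vectors multiplies the inner product by the factor of `ε`, since the second
  -- vector is a multiple of a basis vector, and also by the factor of `δ`, after pulling back by
  -- `U`. A nonzero inner product forces the factors to agree and stays nonzero, so the step can be
  -- iterated.
  have step : ∀ (k : Fin d) (β : Fin d → ℕ) (c c' : ℂ),
      ⟪U (lp.single 2 (i, β) c), (lp.single 2 (j, β) c' : ModelSpace J d)⟫_ℂ ≠ 0 →
      shiftRatio a (δ i) k β = shiftRatio a (ε j) k β ∧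
      ⟪U (lp.single 2 (i, β + Pi.single k 1) ((√(shiftRatio a (δ i) k β) : ℂ) * c)),
        (lp.single 2 (j, β + Pi.single k 1) ((√(shiftRatio a (ε j) k β) : ℂ) * c') :
          ModelSpace J d)⟫_ℂ ≠ 0 := by
    intro k β c c' h
    have h1 := shiftRel_single ha δ k i β c
    have h2 := shiftRel_single ha ε k j β c'
    have h3 : ShiftRel a δ k (U.symm (lp.single 2 (j, β) c')) (U.symm (lp.single 2
        (j, β + Pi.single k 1) ((√(shiftRatio a (ε j) k β) : ℂ) * c'))) := by
      rw [hU, U.apply_symm_apply, U.apply_symm_apply]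
      exact h2
    have h4 := ((hU k _ _).1 h1).inner_eq' ha h2 (r := shiftRatio a (ε j) k β) (by
      intro j' β' hj
      obtain ⟨rfl, rfl⟩ := eq_of_single_apply_ne_zero hj
      rfl)
    have h5 := h1.inner_eq ha h3 (r := shiftRatio a (δ i) k β) (by
      intro j' β' hj
      obtain ⟨rfl, rfl⟩ := eq_of_single_apply_ne_zero hj
      rfl)
    rw [← LinearIsometryEquiv.inner_map_map U, ← LinearIsometryEquiv.inner_map_map U,
      U.apply_symm_apply, U.apply_symm_apply, h4] at h5
    refine ⟨?_, ?_⟩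
    · exact_mod_cast (mul_right_cancel₀ h h5).symm
    · rw [h4]
      exact mul_ne_zero (by exact_mod_cast (shiftRatio_pos ha _ _ _).ne') h
  refine (eq_of_shiftRatio_eq ha had _ _ (fun k => (step k 0 1 1 hfe).1) fun k => ?_).symm
  -- One step from the constants reaches `z_k`, where the second ratio is compared.
  exact (step k _ _ _ (step k 0 1 1 hfe).2).1

/-- The multiplicities are not increased by a unitary intertwining the shifts. -/
lemma card_le_of_intertwining [Fintype I] [Fintype J] [DecidableEq I] [DecidableEq J] {a : ℕ}
    (ha : 0 < a) (had : a * d ≠ 1)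
    {δ : I → Fin d → ℕ} {ε : J → Fin d → ℕ} (U : ModelSpace I d ≃ₗᵢ[ℂ] ModelSpace J d)
    (hU : ∀ k F G, ShiftRel a δ k F G ↔ ShiftRel a ε k (U F) (U G)) (α : Fin d → ℕ) :
    Fintype.card {i // δ i = α} ≤ Fintype.card {j // ε j = α} := by
  have hinj : ∀ i : {i // δ i = α}, U (lp.single 2 ((i : I), 0) 1) ∈
      Submodule.span ℂ (Set.range fun j : {j // ε j = α} =>
        (lp.single 2 ((j : J), 0) 1 : ModelSpace J d)) := by
    intro i
    have : U (lp.single 2 ((i : I), 0) 1) = ∑ j : {j // ε j = α},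
        U (lp.single 2 ((i : I), 0) 1) ((j : J), 0) •
          (lp.single 2 ((j : J), 0) 1 : ModelSpace J d) := by
      ext ⟨j, γ⟩
      rw [lp.coeFn_sum, Finset.sum_apply]
      simp only [lp.coeFn_smul, Pi.smul_apply, smul_eq_mul]
      by_cases h : γ = 0 ∧ ε j = δ i
      · obtain ⟨rfl, hj⟩ := h
        rw [Finset.sum_eq_single ⟨j, hj.trans i.2⟩]
        · simp
        · intro j' _ hj'
          rw [lp.single_apply_ne, mul_zero]
          rintro h
          exact hj' (Subtype.ext (Prod.ext_iff.1 h).1.symm)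
        · simp
      · rw [not_ne_iff.1 (mt (map_single_apply ha had U hU i j γ) h), Finset.sum_eq_zero]
        intro j' _
        rw [lp.single_apply_ne, mul_zero]
        rintro h'
        obtain ⟨h1, h2⟩ := Prod.ext_iff.1 h'
        simp only at h1 h2
        exact h ⟨h2, by rw [h1, j'.2, i.2]⟩
    rw [this]
    exact Submodule.sum_mem _ fun j _ => Submodule.smul_mem _ _ (Submodule.subset_span ⟨j, rfl⟩)
  have hon : Orthonormal ℂ fun i : {i // δ i = α} => U (lp.single 2 ((i : I), 0) 1) := by
    rw [orthonormal_iff_ite]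
    intro i i'
    rw [LinearIsometryEquiv.inner_map_map, lp.inner_single_left, RCLike.inner_apply]
    split_ifs with h
    · subst h
      simp
    · rw [lp.single_apply_ne, zero_mul]
      rintro h'
      exact h (Subtype.ext (Prod.ext_iff.1 h').1)
  have hli := hon.linearIndependent
  set S := Submodule.span ℂ (Set.range fun j : {j // ε j = α} =>
        (lp.single 2 ((j : J), 0) 1 : ModelSpace J d))
  have hli' : LinearIndependent ℂ fun i : {i // δ i = α} => (⟨_, hinj i⟩ : S) :=
    LinearIndependent.of_comp S.subtype hli
  have : FiniteDimensional ℂ S := FiniteDimensional.span_of_finite ℂ (Set.finite_range _)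
  exact hli'.fintype_card_le_finrank.trans (finrank_range_le_card _)

theorem card_eq_of_intertwining [Fintype I] [Fintype J] [DecidableEq I] [DecidableEq J] {a : ℕ}
    (ha : 0 < a) (had : a * d ≠ 1)
    {δ : I → Fin d → ℕ} {ε : J → Fin d → ℕ} (U : ModelSpace I d ≃ₗᵢ[ℂ] ModelSpace J d)
    (hU : ∀ k F G, ShiftRel a δ k F G ↔ ShiftRel a ε k (U F) (U G)) (α : Fin d → ℕ) :
    Fintype.card {i // δ i = α} = Fintype.card {j // ε j = α} := by
  refine le_antisymm (card_le_of_intertwining ha had U hU α)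
    (card_le_of_intertwining ha had U.symm (fun k F G => ?_) α)
  rw [hU, U.apply_symm_apply, U.apply_symm_apply]

end

section

/-! ### Generations of a tree -/

namespace RootedTree

variable {V : Type*} {T : RootedTree V}

lemma depth_eq_zero_iff {v : V} : T.depth v = 0 ↔ v = T.root :=
  mem_rootChildren_iff.symm

lemma depth_child {u v : V} (h : T.Edge u v) : T.depth v = T.depth u + 1 :=
  mem_rootChildren_iff.1 ⟨u, mem_rootChildren_iff.2 rfl, h⟩

lemma ne_root_of_edge {u v : V} (h : T.Edge u v) : v ≠ T.root := by
  rintro rfl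
  exact T.root_not_child u h

lemma parent_root : T.parent T.root = T.root := by
  rw [parent, dif_neg]
  rintro ⟨u, hu⟩
  exact T.root_not_child u hu

/-- The convention that the root is its own parent matches truncated subtraction at `0`; this treats
the directions outside `F` uniformly. -/
lemma depth_parent (v : V) : T.depth (T.parent v) = T.depth v - 1 := by
  by_cases h : v = T.root
  · rw [h, parent_root, depth_eq_zero_iff.2 rfl]
  · rw [depth_child (edge_parent h), Nat.add_sub_cancel]

lemma mem_sib_iff {v w : V} (hv : v ≠ T.root) :
    w ∈ T.sib v ↔ w ≠ T.root ∧ T.parent w = T.parent v := by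
  constructor
  · rintro ⟨p, hpv, hpw⟩
    exact ⟨ne_root_of_edge hpw, by rw [parent_eq hpv, parent_eq hpw]⟩
  · rintro ⟨hw, h⟩
    exact ⟨T.parent v, edge_parent hv, h ▸ edge_parent hw⟩

lemma sib_eq_children {v : V} (hv : v ≠ T.root) : T.sib v = T.children (T.parent v) := by
  ext w
  constructor
  · rintro ⟨p, hpv, hpw⟩
    rw [parent_eq hpv]
    exact hpw
  · intro h
    exact ⟨_, edge_parent hv, h⟩

lemma self_mem_sib {v : V} (hv : v ≠ T.root) : v ∈ T.sib v :=
  (mem_sib_iff hv).2 ⟨hv, rfl⟩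

lemma ne_root_of_mem_sib {v w : V} (h : w ∈ T.sib v) : w ≠ T.root := by
  obtain ⟨p, _, hp⟩ := h
  exact ne_root_of_edge hp

lemma ncard_children_pos (v : V) : 0 < (T.children v).ncard :=
  (Set.ncard_pos (T.locally_finite v)).2 (T.leafless v)

lemma finite_rootChildren (n : ℕ) : (T.rootChildren n).Finite := by
  induction n with
  | zero => exact Set.finite_singleton _
  | succ n ih =>
    have : T.rootChildren (n + 1) = ⋃ v ∈ T.rootChildren n, {w | T.Edge v w} := by
      ext w
      simp [rootChildren]
    rw [this]
    exact ih.biUnion fun v _ => T.locally_finite v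

lemma finite_generation (n : ℕ) : (T.generation n).Finite :=
  (finite_rootChildren n).subset fun _ hv => mem_rootChildren_iff.2 hv

variable (T) in
/-- The `n`-th generation as a finite set. -/
def gen (n : ℕ) : Finset V := (finite_generation (T := T) n).toFinset

lemma mem_gen {n : ℕ} {v : V} : v ∈ T.gen n ↔ T.depth v = n :=
  (Set.Finite.mem_toFinset _).trans Iff.rfl

lemma gen_zero : T.gen 0 = {T.root} := by
  ext v
  rw [mem_gen, depth_eq_zero_iff, Finset.mem_singleton]

lemma encard_generation (n : ℕ) : (T.generation n).encard = (T.gen n).card := by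
  rw [(finite_generation n).encard_eq_coe_toFinset_card]
  rfl

lemma card_gen_succ (n : ℕ) :
    (T.gen (n + 1)).card = ∑ v ∈ T.gen n, (T.children v).ncard := by
  classical
  rw [Finset.card_eq_sum_card_fiberwise (f := T.parent) (t := T.gen n)]
  · refine Finset.sum_congr rfl fun v hv => ?_
    rw [← Set.ncard_coe_finset]
    congr 1
    ext w
    simp only [Finset.coe_filter, mem_gen, Set.mem_ofPred_eq, children]
    constructor
    · rintro ⟨h1, rfl⟩
      refine edge_parent fun h => ?_
      rw [depth_eq_zero_iff.2 h] at h1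
      omega
    · intro h
      rw [depth_child h, mem_gen.1 hv, parent_eq h]
      exact ⟨rfl, rfl⟩
  · intro w hw
    have := mem_gen.1 (Finset.mem_coe.1 hw)
    rw [Finset.mem_coe, mem_gen, depth_parent, this, Nat.add_sub_cancel]

lemma card_gen_le_succ (n : ℕ) : (T.gen n).card ≤ (T.gen (n + 1)).card := by
  rw [card_gen_succ, Finset.card_eq_sum_ones]
  exact Finset.sum_le_sum fun v _ => ncard_children_pos v

/-- Children partition the next generation by parent. Leaflessness keeps each truncated difference
honest. -/
lemma sum_ncard_children_sub_one (n : ℕ) :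
    ∑ v ∈ T.gen n, ((T.children v).ncard - 1) = (T.gen (n + 1)).card - (T.gen n).card := by
  rw [Finset.sum_tsub_distrib _ fun v _ => ncard_children_pos v, ← card_gen_succ,
    ← Finset.card_eq_sum_ones]

/-- The parent is a branching vertex of depth one less, and the branching index adds this one back.
-/
lemma depth_le_branchingIndex {v : V} (hv : v ≠ T.root) (h : 2 ≤ (T.sib v).ncard) :
    (T.depth v : ℕ∞) ≤ T.branchingIndex := by
  have hbr : T.parent v ∈ T.branching := by
    rw [sib_eq_children hv] at h
    change 2 ≤ (T.children (T.parent v)).encard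
    have hf : (T.children (T.parent v)).Finite := T.locally_finite _
    rw [← hf.cast_ncard_eq]
    exact_mod_cast h
  refine le_trans (le_of_eq ?_) (le_iSup₂_of_le (T.parent v) hbr le_rfl)
  rw [depth_child (edge_parent hv)]
  push_cast
  rfl

end RootedTree

end

section

/-! ### The solution spaces -/

variable {d : ℕ} {V : Fin d → Type*} (T : ∀ j, RootedTree (V j))

lemma weight_pos {a : ℕ} (ha : 0 < a) (j : Fin d) (w : ∀ j, V j) : 0 < weight T a j w := by
  have ha' : (0 : ℝ) < a := by exact_mod_cast ha
  have hd : (0 : ℝ) < d := by exact_mod_cast Fin.pos j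
  have hc : 0 < (childi T j (parenti T j w)).ncard := by
    refine (Set.ncard_pos (childi_finite T j _)).2 ?_
    exact Set.Nonempty.image _ ((T j).leafless (parenti T j w j))
  have hc' : (0 : ℝ) < (childi T j (parenti T j w)).ncard := by exact_mod_cast hc
  unfold weight daSeq
  refine mul_pos (Real.sqrt_pos.2 (by positivity)) (Real.sqrt_pos.2 (by positivity))

lemma parenti_update (j : Fin d) (v : ∀ j, V j) (x : V j) :
    parenti T j (Function.update v j x) = Function.update v j ((T j).parent x) := by
  simp [parenti]

/-- The weight sees a vertex only through its parent in direction `j`, hence is constant along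
siblings. -/
lemma weight_update (a : ℕ) (j : Fin d) (v : ∀ j, V j) {x y : V j}
    (h : (T j).parent x = (T j).parent y) :
    weight T a j (Function.update v j x) = weight T a j (Function.update v j y) := by
  simp only [weight, parenti_update, h]

variable {T}

lemma self_mem_sibF {F : Finset (Fin d)} {u : ∀ j, V j} (hu : u ∈ Phi T F) : u ∈ sibF T F u :=
  ⟨fun j hj => RootedTree.self_mem_sib (hu.1 j hj), fun _ _ => rfl⟩

lemma mem_Phi_of_mem_sibF {F : Finset (Fin d)} {u w : ∀ j, V j} (hu : u ∈ Phi T F)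
    (hw : w ∈ sibF T F u) : w ∈ Phi T F :=
  ⟨fun j hj => RootedTree.ne_root_of_mem_sib (hw.1 j hj), fun j hj => by
    rw [hw.2 j hj, hu.2 j hj]⟩

lemma update_mem_sibF {F : Finset (Fin d)} {u v : ∀ j, V j} {j : Fin d} (hj : j ∈ F)
    (hv : v ∈ sibF T F u) {x : V j} (hx : x ∈ (T j).sib (u j)) :
    Function.update v j x ∈ sibF T F u := by
  refine ⟨fun i hi => ?_, fun i hi => ?_⟩
  · rcases eq_or_ne i j with rfl | hij
    · simpa using hx
    · simpa [hij] using hv.1 i hi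
  · rw [Function.update_of_ne (fun h : i = j => hi (h ▸ hj))]
    exact hv.2 i hi

lemma finite_sibF (F : Finset (Fin d)) (u : ∀ j, V j) : (sibF T F u).Finite := by
  classical
  refine (Set.Finite.pi' (t := fun j => (T j).sib (u j) ∪ {u j}) fun j =>
    (RootedTree.finite_sib _).union (Set.finite_singleton _)).subset ?_
  intro w hw j
  by_cases hj : j ∈ F
  · exact Or.inl (hw.1 j hj)
  · exact Or.inr (hw.2 j hj)

variable (T) in
/-- The siblings of a vertex of a factor as a finite set. -/
def sibFinset (j : Fin d) (x : V j) : Finset (V j) :=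
  (RootedTree.finite_sib (T := T j) x).toFinset

lemma mem_sibFinset {j : Fin d} {x y : V j} : y ∈ sibFinset T j x ↔ y ∈ (T j).sib x :=
  Set.Finite.mem_toFinset _

lemma card_sibFinset (j : Fin d) (x : V j) : (sibFinset T j x).card = ((T j).sib x).ncard :=
  (Set.ncard_eq_toFinset_card _ _).symm

/-- The weights drop out of the equations defining `solutionSpace`. -/
lemma mem_solutionSpace_iff {a : ℕ} (ha : 0 < a) {F : Finset (Fin d)} {u : ∀ j, V j}
    (hu : u ∈ Phi T F) (f : L2 V) : f ∈ solutionSpace T a F u ↔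
      (∀ v, v ∉ sibF T F u → f v = 0) ∧ ∀ j ∈ F, ∀ v ∈ sibF T F u,
        ∑ x ∈ sibFinset T j (u j), f (Function.update v j x) = 0 := by
  refine and_congr Iff.rfl (forall₂_congr fun j hj => forall₂_congr fun v hv => ?_)
  -- Resetting the coordinates outside `F` to the roots changes nothing, because `u ∈ Φ_F` has roots
  -- there already and `v` agrees with `u` there.
  have hbase : Function.update (restr T (F.erase j) v) j (u j) = Function.update v j (u j) := by
    funext i
    rcases eq_or_ne i j with rfl | hij
    · simp
    · rw [Function.update_of_ne hij, Function.update_of_ne hij, restr]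
      split_ifs with hi
      · rfl
      · have hiF : i ∉ F := fun h => hi (Finset.mem_erase.2 ⟨hij, h⟩)
        rw [hv.2 i hiF, hu.2 i hiF]
  rw [hbase, sibi, finsum_mem_image (fun x _ y _ h => by simpa using congrFun h j)]
  simp only [Function.update_idem, Function.update_self]
  rw [finsum_mem_eq_finite_toFinset_sum _ (RootedTree.finite_sib (u j))]
  have hw : (weight T a j (Function.update v j (u j)) : ℂ) ≠ 0 := by
    exact_mod_cast (weight_pos T ha j _).ne'
  change (∑ x ∈ sibFinset T j (u j), _) = 0 ↔ _
  rw [Finset.sum_congr rfl (g := fun x => f (Function.update v j x) *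
    (weight T a j (Function.update v j (u j)) : ℂ)) fun x hx => by
      rw [weight_update T a j v
        ((RootedTree.mem_sib_iff (hu.1 j hj)).1 (mem_sibFinset.1 hx)).2],
    ← Finset.sum_mul, mul_eq_zero, or_iff_left hw]

open Classical in
/-- Index set of the coordinates of `solutionSpace`: choices of siblings different from the given
vertex. -/
abbrev ProperSib (T : ∀ j, RootedTree (V j)) (F : Finset (Fin d)) (u : ∀ j, V j) : Type _ :=
  ∀ j : F, {x // x ∈ (sibFinset T j (u j)).erase (u j)}

open Classical in
/-- The vertex of the product with the coordinates `x` in the directions of `F`. -/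
def ProperSib.vertex {F : Finset (Fin d)} {u : ∀ j, V j} (x : ProperSib T F u) : ∀ j, V j :=
  fun j => if h : j ∈ F then x ⟨j, h⟩ else u j

open Classical in
lemma ProperSib.vertex_apply {F : Finset (Fin d)} {u : ∀ j, V j} (x : ProperSib T F u) (j : F) :
    x.vertex j = x j := by
  simp [vertex]

lemma ProperSib.vertex_mem {F : Finset (Fin d)} {u : ∀ j, V j} (x : ProperSib T F u) :
    x.vertex ∈ sibF T F u := by
  refine ⟨fun j hj => ?_, fun j hj => by simp [vertex, hj]⟩
  rw [x.vertex_apply ⟨j, hj⟩]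
  classical
  exact mem_sibFinset.1 (Finset.mem_of_mem_erase (x ⟨j, hj⟩).2)

/-- Induction on the number of directions in `F` in which `w` agrees with `u`. With none, `w` is one
of the prescribed vertices. Otherwise the equation in an agreeing direction expresses `f w` through
values at vertices with fewer agreements. -/
lemma eq_zero_of_vertex {a : ℕ} (ha : 0 < a) {F : Finset (Fin d)} {u : ∀ j, V j}
    (hu : u ∈ Phi T F) {f : L2 V} (hf : f ∈ solutionSpace T a F u)
    (h0 : ∀ x : ProperSib T F u, f x.vertex = 0) : f = 0 := by
  classical
  obtain ⟨hsupp, heq⟩ := (mem_solutionSpace_iff ha hu f).1 hf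
  have key : ∀ (n : ℕ), ∀ w ∈ sibF T F u, (F.filter fun j => w j = u j).card = n → f w = 0 := by
    intro n
    induction n using Nat.strong_induction_on with
    | _ n ih =>
      intro w hw hn
      rcases (F.filter fun j => w j = u j).eq_empty_or_nonempty with he | ⟨j, hj⟩
      · have hne : ∀ j ∈ F, w j ≠ u j := fun j hj h => by
          have : j ∈ F.filter fun j => w j = u j := Finset.mem_filter.2 ⟨hj, h⟩
          simp [he] at this
        set x : ProperSib T F u := fun j => ⟨w j, Finset.mem_erase.2
          ⟨hne j j.2, mem_sibFinset.2 (hw.1 j j.2)⟩⟩ with hx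
        have : x.vertex = w := by
          funext j
          by_cases hj : j ∈ F
          · simp [ProperSib.vertex, hj, hx]
          · simp [ProperSib.vertex, hj, hw.2 j hj]
        rw [← this]
        exact h0 x
      · obtain ⟨hjF, hju⟩ := Finset.mem_filter.1 hj
        have hs := heq j hjF w hw
        rw [Finset.sum_eq_single (u j)] at hs
        · rwa [← hju, Function.update_eq_self] at hs
        · intro y hy hyu
          refine ih _ ?_ _ (update_mem_sibF hjF hw (mem_sibFinset.1 hy)) rfl
          rw [← hn]
          refine Finset.card_lt_card ⟨?_, ?_⟩
          · intro i hi
            obtain ⟨hiF, hi2⟩ := Finset.mem_filter.1 hi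
            rcases eq_or_ne i j with rfl | hij
            · exact hj
            · exact Finset.mem_filter.2 ⟨hiF, by simpa [hij] using hi2⟩
          · intro h
            have := (Finset.mem_filter.1 (h hj)).2
            exact hyu (by simpa using this)
        · intro h
          exact absurd (mem_sibFinset.2 (RootedTree.self_mem_sib (hu.1 j hjF))) h
  ext w
  by_cases hw : w ∈ sibF T F u
  · exact key _ w hw rfl
  · exact hsupp w hw

open Classical in
/-- The function with prescribed values at the vertices with no coordinate in common with `u` in
the directions of `F`, and with vanishing sums along the siblings. -/
def extendFun {F : Finset (Fin d)} {u : ∀ j, V j} (g : ProperSib T F u → ℂ) (w : ∀ j, V j) : ℂ :=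
  if w ∈ sibF T F u then
    ∑ x : ProperSib T F u, g x * ∏ j : F,
      ((if w j = x j then 1 else 0) - (if w j = u j then 1 else 0))
  else 0

/-- `extendFun` combines the tensor products over `j ∈ F` of `δ_{x_j} - δ_{u_j}`. At a vertex
avoiding every `u_j` only the tensor product with the same `x` survives. -/
lemma extendFun_vertex {F : Finset (Fin d)} {u : ∀ j, V j} (g : ProperSib T F u → ℂ)
    (x : ProperSib T F u) : extendFun g x.vertex = g x := by
  classical
  rw [extendFun, if_pos x.vertex_mem, Finset.sum_eq_single x]
  · rw [Finset.prod_eq_one, mul_one]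
    intro j _
    rw [x.vertex_apply, if_pos rfl, if_neg (Finset.mem_erase.1 (x j).2).1, sub_zero]
  · intro y _ hy
    obtain ⟨j, hj⟩ := Function.ne_iff.1 hy
    rw [Finset.prod_eq_zero (Finset.mem_univ j), mul_zero]
    rw [x.vertex_apply, if_neg (fun h : (x j : V j) = y j => hj (Subtype.ext h.symm)),
      if_neg (Finset.mem_erase.1 (x j).2).1, sub_zero]
  · simp

/-- In each tensor product the factor in direction `j` sums to `1 - 1 = 0` over the siblings. -/
lemma sum_extendFun {F : Finset (Fin d)} {u : ∀ j, V j} (hu : u ∈ Phi T F)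
    (g : ProperSib T F u → ℂ) {j : Fin d} (hj : j ∈ F) {v : ∀ j, V j} (hv : v ∈ sibF T F u) :
    ∑ y ∈ sibFinset T j (u j), extendFun g (Function.update v j y) = 0 := by
  classical
  refine (Finset.sum_congr rfl fun y hy =>
    if_pos (update_mem_sibF hj hv (mem_sibFinset.1 hy))).trans ?_
  rw [Finset.sum_comm]
  refine Finset.sum_eq_zero fun x _ => ?_
  rw [← Finset.mul_sum]
  refine mul_eq_zero_of_right _ ?_
  obtain ⟨t, ht⟩ : ∃ t : V j, t = x ⟨j, hj⟩ := ⟨_, rfl⟩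
  have hx : t ∈ sibFinset T j (u j) := ht ▸ Finset.mem_of_mem_erase (x ⟨j, hj⟩).2
  have husib : u j ∈ sibFinset T j (u j) :=
    mem_sibFinset.2 (RootedTree.self_mem_sib (hu.1 j hj))
  set c : ℂ := ∏ i ∈ Finset.univ.erase (⟨j, hj⟩ : F),
      ((if v i = x i then 1 else 0) - (if v i = u i then 1 else 0))
  have hprod : ∀ y ∈ sibFinset T j (u j), ∏ i : F,
      ((if Function.update v j y i = x i then (1 : ℂ) else 0) -
        (if Function.update v j y i = u i then 1 else 0)) =
      ((if y = t then 1 else 0) - (if y = u j then 1 else 0)) * c := by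
    intro y _
    rw [← Finset.mul_prod_erase _ _ (Finset.mem_univ (⟨j, hj⟩ : F))]
    congr 1
    · simp [ht]
    · refine Finset.prod_congr rfl fun i hi => ?_
      have hij : (i : Fin d) ≠ j := fun h => (Finset.mem_erase.1 hi).1 (Subtype.ext h)
      rw [Function.update_of_ne hij]
  refine (Finset.sum_congr rfl hprod).trans ?_
  rw [← Finset.sum_mul, Finset.sum_sub_distrib, Finset.sum_ite_eq', Finset.sum_ite_eq',
    if_pos hx, if_pos husib, sub_self, zero_mul]

lemma memℓp_extendFun {F : Finset (Fin d)} {u : ∀ j, V j} (g : ProperSib T F u → ℂ) :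
    Memℓp (extendFun g) 2 := by
  refine memℓp_gen (summable_of_ne_finset_zero (s := (finite_sibF (T := T) F u).toFinset) ?_)
  intro w hw
  rw [Set.Finite.mem_toFinset] at hw
  simp [extendFun, hw]

/-- An element of `solutionSpace` is determined by its values at the vertices with no coordinate
in common with `u` in the directions of `F`, and these values are arbitrary. -/
def solutionSpaceEquiv {a : ℕ} (ha : 0 < a) {F : Finset (Fin d)} {u : ∀ j, V j}
    (hu : u ∈ Phi T F) : solutionSpace T a F u ≃ₗ[ℂ] (ProperSib T F u → ℂ) :=
  LinearEquiv.ofBijective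
    ({ toFun := fun f x => (f : L2 V) x.vertex
       map_add' := fun _ _ => rfl
       map_smul' := fun _ _ => rfl } : solutionSpace T a F u →ₗ[ℂ] (ProperSib T F u → ℂ))
    ⟨by
      rw [injective_iff_map_eq_zero]
      intro f hf
      exact Subtype.ext (eq_zero_of_vertex ha hu f.2 fun x => congrFun hf x), by
      intro g
      refine ⟨⟨⟨extendFun g, memℓp_extendFun g⟩, (mem_solutionSpace_iff ha hu _).2 ⟨?_, ?_⟩⟩, ?_⟩
      · intro v hv
        exact if_neg hv
      · intro j hj v hv
        exact sum_extendFun hu g hj hv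
      · funext x
        exact extendFun_vertex g x⟩

lemma finiteDimensional_solutionSpace {a : ℕ} (ha : 0 < a) {F : Finset (Fin d)} {u : ∀ j, V j}
    (hu : u ∈ Phi T F) : FiniteDimensional ℂ (solutionSpace T a F u) :=
  (solutionSpaceEquiv ha hu).symm.finiteDimensional

/-- `dim 𝓛_{u,F} = ∏_{j ∈ F} (card sib(u_j) - 1)`. -/
lemma finrank_solutionSpace {a : ℕ} (ha : 0 < a) {F : Finset (Fin d)} {u : ∀ j, V j}
    (hu : u ∈ Phi T F) : Module.finrank ℂ (solutionSpace T a F u) =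
      ∏ j ∈ F, (((T j).sib (u j)).ncard - 1) := by
  classical
  rw [(solutionSpaceEquiv ha hu).finrank_eq, Module.finrank_fintype_fun_eq_card, Fintype.card_pi,
    ← Finset.prod_coe_sort F fun j => ((T j).sib (u j)).ncard - 1]
  refine Finset.prod_congr rfl fun j _ => ?_
  rw [Fintype.card_coe, Finset.card_erase_of_mem (mem_sibFinset.2
    (RootedTree.self_mem_sib (hu.1 j j.2))), card_sibFinset]

/-- `𝓛_{u,F} ⊆ E`. -/
lemma solutionSpace_le_jointKernel {a : ℕ} (ha : 0 < a) {F : Finset (Fin d)} {u : ∀ j, V j}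
    (hu : u ∈ Phi T F) : solutionSpace T a F u ≤ jointKernel T a := by
  classical
  intro f hf
  obtain ⟨hsupp, heq⟩ := (mem_solutionSpace_iff ha hu f).1 hf
  refine (Submodule.mem_iInf _).2 fun j => ?_
  rw [LinearMap.mem_ker]
  change ContinuousLinearMap.adjoint (multishift T a j) f = 0
  ext x
  -- The coordinate of `S_j^* f` at `x` is `⟪S_j e_x, f⟫`, a sum over the children of `x` in
  -- direction `j`.
  have h1 : ⟪lp.single 2 x (1 : ℂ), ContinuousLinearMap.adjoint (multishift T a j) f⟫_ℂ =
      (ContinuousLinearMap.adjoint (multishift T a j) f : L2 V) x := by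
    rw [lp.inner_single_left, RCLike.inner_apply]
    simp
  rw [← h1, ContinuousLinearMap.adjoint_inner_right, lp.inner_eq_tsum]
  set η : (∀ j, V j) → ℂ := fun v =>
    ⟪(multishift T a j (lp.single 2 x (1 : ℂ)) : L2 V) v, f v⟫_ℂ with hη
  change ∑' v, η v = 0
  have hη0 : ∀ v, η v ≠ 0 → v ∈ sibF T F u ∧ j ∈ F ∧ parenti T j v = x := by
    intro v hv
    have hfv : f v ≠ 0 := fun h => hv (by simp [hη, h])
    have hvs : v ∈ sibF T F u := by
      by_contra h
      exact hfv (hsupp v h)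
    have hsh : shiftFun T a j (lp.single 2 x (1 : ℂ) : L2 V) v ≠ 0 := by
      intro h
      refine hv ?_
      simp only [hη, multishift_apply, h, inner_zero_left]
    have hroot : v j ≠ (T j).root := fun h => hsh (if_pos h)
    refine ⟨hvs, ?_, ?_⟩
    · by_contra h
      exact hroot (by rw [hvs.2 j h, hu.2 j h])
    · by_contra h
      refine hsh ?_
      rw [shiftFun, if_neg hroot, lp.single_apply_ne _ _ _ h, mul_zero]
  by_cases hex : ∃ v, η v ≠ 0
  · obtain ⟨v, hv⟩ := hex
    obtain ⟨hvs, hjF, hpar⟩ := hη0 v hv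
    have hinj : Function.Injective (Function.update v j) := Function.update_injective v j
    have hsib : ∀ y ∈ sibFinset T j (u j), (T j).parent y = (T j).parent (v j) := by
      intro y hy
      rw [((RootedTree.mem_sib_iff (hu.1 j hjF)).1 (mem_sibFinset.1 hy)).2,
        ((RootedTree.mem_sib_iff (hu.1 j hjF)).1 (hvs.1 j hjF)).2]
    -- Once one term is nonzero, all nonzero terms lie on the sibling line through `v`. The weight
    -- is constant there, so the sum is a multiple of a defining equation of `𝓛_{u,F}`.
    rw [tsum_eq_sum (s := (sibFinset T j (u j)).image (Function.update v j)), Finset.sum_image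
      hinj.injOn]
    · have hterm : ∀ y ∈ sibFinset T j (u j), η (Function.update v j y) =
          (weight T a j v : ℂ) * f (Function.update v j y) := by
        intro y hy
        have hroot : Function.update v j y j ≠ (T j).root := by
          rw [Function.update_self]
          exact RootedTree.ne_root_of_mem_sib (mem_sibFinset.1 hy)
        have hp : parenti T j (Function.update v j y) = x := by
          rw [parenti_update, hsib y hy]
          exact hpar
        have hw : weight T a j (Function.update v j y) = weight T a j v := by
          conv_rhs => rw [← Function.update_eq_self j v]
          exact weight_update T a j v (hsib y hy)
        simp only [hη, multishift_apply, shiftFun, if_neg hroot, hp, hw, lp.single_apply_self,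
          mul_one, RCLike.inner_apply, Complex.conj_ofReal]
        ring
      rw [Finset.sum_congr rfl hterm, ← Finset.mul_sum, heq j hjF v hvs, mul_zero]
    · intro w hw
      by_contra hne
      obtain ⟨hws, _, hwp⟩ := hη0 w hne
      refine hw (Finset.mem_image.2 ⟨w j, mem_sibFinset.2 (hws.1 j hjF), ?_⟩)
      funext i
      rcases eq_or_ne i j with rfl | hij
      · simp
      · have := congrFun (hpar.trans hwp.symm) i
        simp only [parenti, Function.update_of_ne hij] at this
        rw [Function.update_of_ne hij, this]
  · rw [tsum_congr fun v => not_not.1 (not_exists.1 hex v), tsum_zero]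

end

section

/-! ### Multiplicities -/

variable {d : ℕ} {V : Fin d → Type*} {T : ∀ j, RootedTree (V j)}

lemma mem_iff_depth_ne_zero {F : Finset (Fin d)} {u : ∀ j, V j} (hu : u ∈ Phi T F) (j : Fin d) :
    j ∈ F ↔ depth T u j ≠ 0 := by
  rw [depth, Ne, RootedTree.depth_eq_zero_iff]
  exact ⟨hu.1 j, fun h => by_contra fun hj => h (hu.2 j hj)⟩

lemma finite_depth_eq (α : Fin d → ℕ) : {u : ∀ j, V j | depth T u = α}.Finite := by
  refine (Set.Finite.pi' (t := fun j => (T j).generation (α j)) fun j =>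
    RootedTree.finite_generation _).subset ?_
  intro u hu j
  exact congrFun hu j

lemma sib_pos {F : Finset (Fin d)} {u : ∀ j, V j} (hu : u ∈ Phi T F) {j : Fin d} (hj : j ∈ F) :
    0 < ((T j).sib (u j)).ncard := by
  rw [RootedTree.sib_eq_children (hu.1 j hj)]
  exact RootedTree.ncard_children_pos _

/-- The number of vertices by which a factor grows from one generation to the next governs the
dimension of the solution spaces of a given depth. -/
lemma finsum_finrank_solutionSpace {a : ℕ} (ha : 0 < a) {F : Finset (Fin d)}
    {Ω : Set (∀ j, V j)} (hΩ : IsIndexingSet T F Ω) (α : Fin d → ℕ) (hα : ∀ j, j ∈ F ↔ α j ≠ 0) :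
    ∑ᶠ u ∈ {u | u ∈ Ω ∧ depth T u = α}, Module.finrank ℂ (solutionSpace T a F u) =
      ∏ j ∈ F, (((T j).gen (α j)).card - ((T j).gen (α j - 1)).card) := by
  classical
  have hfin : {u | u ∈ Ω ∧ depth T u = α}.Finite := (finite_depth_eq α).subset fun _ h => h.2
  have hmem : ∀ u, u ∈ hfin.toFinset ↔ u ∈ Ω ∧ depth T u = α := fun u => hfin.mem_toFinset
  rw [finsum_mem_eq_finite_toFinset_sum _ hfin]
  -- Directions outside `F` contribute the neutral factor `1`; there the only possible parent is the
  -- root.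
  set f : ∀ j, V j → ℕ := fun j x => if j ∈ F then ((T j).children x).ncard - 1 else 1 with hf
  have hbij : ∑ u ∈ hfin.toFinset, Module.finrank ℂ (solutionSpace T a F u) =
      ∑ p ∈ Fintype.piFinset fun j => (T j).gen (α j - 1), ∏ j, f j (p j) := by
    -- Representatives of depth `α` correspond to tuples of parents: injectivity is uniqueness of
    -- the representative of a class, and surjectivity chooses children of the given parents and
    -- passes to the representative.
    refine Finset.sum_bij (fun u _ j => (T j).parent (u j)) ?_ ?_ ?_ ?_
    · intro u hu
      rw [Fintype.mem_piFinset]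
      intro j
      rw [RootedTree.mem_gen, RootedTree.depth_parent]
      rw [← ((hmem u).1 hu).2, depth]
    · intro u hu u' hu' h
      have hu1 := hΩ.1 ((hmem u).1 hu).1
      have hu1' := hΩ.1 ((hmem u').1 hu').1
      refine (hΩ.2 u hu1).unique ⟨((hmem u).1 hu).1, self_mem_sibF hu1⟩
        ⟨((hmem u').1 hu').1, fun j hj => ?_, fun j hj => ?_⟩
      · exact (RootedTree.mem_sib_iff (hu1'.1 j hj)).2 ⟨hu1.1 j hj, congrFun h j⟩
      · rw [hu1.2 j hj, hu1'.2 j hj]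
    · intro p hp
      have hp' : ∀ j, (T j).depth (p j) = α j - 1 := fun j =>
        RootedTree.mem_gen.1 (Fintype.mem_piFinset.1 hp j)
      choose c hc using fun j => (T j).leafless (p j)
      set v : ∀ j, V j := fun j => if j ∈ F then c j else (T j).root with hv
      have hvF : v ∈ Phi T F := by
        refine ⟨fun j hj => ?_, fun j hj => if_neg hj⟩
        rw [hv]
        simp only [if_pos hj]
        exact RootedTree.ne_root_of_edge (hc j)
      obtain ⟨u, ⟨huΩ, huv⟩, -⟩ := hΩ.2 v hvF
      have huF := hΩ.1 huΩ
      have hpar : ∀ j, (T j).parent (u j) = p j := by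
        intro j
        by_cases hj : j ∈ F
        · rw [← ((RootedTree.mem_sib_iff (huF.1 j hj)).1 (huv.1 j hj)).2, hv]
          simp only [if_pos hj]
          exact RootedTree.parent_eq (hc j)
        · have h0 : α j = 0 := not_not.1 (mt (hα j).2 hj)
          rw [huF.2 j hj, RootedTree.parent_root]
          refine (RootedTree.depth_eq_zero_iff.1 ?_).symm
          rw [hp', h0]
      refine ⟨u, (hmem u).2 ⟨huΩ, ?_⟩, funext hpar⟩
      funext j
      by_cases hj : j ∈ F
      · have h1 := RootedTree.depth_child (RootedTree.edge_parent (huF.1 j hj))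
        have h2 := (hα j).1 hj
        rw [hpar, hp'] at h1
        rw [depth, h1]
        omega
      · rw [not_not.1 (mt (hα j).2 hj)]
        exact not_not.1 (mt (mem_iff_depth_ne_zero huF j).2 hj)
    · intro u hu
      have huF := hΩ.1 ((hmem u).1 hu).1
      rw [finrank_solutionSpace ha huF, hf, Finset.prod_ite_mem, Finset.univ_inter]
      refine Finset.prod_congr rfl fun j hj => ?_
      rw [RootedTree.sib_eq_children (huF.1 j hj)]
  -- By distributivity the sum over tuples of parents becomes a product of sums over generations.
  rw [hbij, ← Finset.prod_univ_sum]
  rw [← Finset.univ_inter F, ← Finset.prod_ite_mem]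
  refine Finset.prod_congr rfl fun j _ => ?_
  by_cases hj : j ∈ F
  · have h1 : α j - 1 + 1 = α j := Nat.succ_pred_eq_of_ne_zero ((hα j).1 hj)
    simp only [hf, if_pos hj]
    rw [RootedTree.sum_ncard_children_sub_one, h1]
  · have h0 : α j = 0 := not_not.1 (mt (hα j).2 hj)
    simp [hf, hj, h0, RootedTree.gen_zero]

/-- The support of the depth of a vertex of `Φ_F` is `F`, so each `α` meets only one `F`. -/
lemma not_mem_of_support_ne {F : Finset (Fin d)} {Ω : Set (∀ j, V j)} (hΩ : Ω ⊆ Phi T F)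
    {α : Fin d → ℕ} (hα : ¬ ∀ j, j ∈ F ↔ α j ≠ 0) :
    {u | u ∈ Ω ∧ depth T u = α} = ∅ := by
  refine Set.eq_empty_of_forall_notMem fun u hu => hα ?_
  rw [← hu.2]
  exact mem_iff_depth_ne_zero (hΩ hu.1)

/-- In the case of a single direction, the multiplicity counts the branching. -/
lemma finsum_ncard_sibi {a : ℕ} (ha : 0 < a) {l : Fin d} {Ω : Set (∀ j, V j)}
    (hΩ : IsIndexingSet T {l} Ω) (α : Fin d → ℕ) :
    ∑ᶠ u ∈ {u | u ∈ Ω ∧ depth T u = α}, (((sibi T l u).ncard : ℤ) - 1) =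
      ((∑ᶠ u ∈ {u | u ∈ Ω ∧ depth T u = α},
        Module.finrank ℂ (solutionSpace T a {l} u) : ℕ) : ℤ) := by
  have hfin : {u | u ∈ Ω ∧ depth T u = α}.Finite := (finite_depth_eq α).subset fun _ h => h.2
  rw [finsum_mem_eq_finite_toFinset_sum _ hfin, finsum_mem_eq_finite_toFinset_sum _ hfin,
    Nat.cast_sum]
  refine Finset.sum_congr rfl fun u hu => ?_
  have huF := hΩ.1 (hfin.mem_toFinset.1 hu).1
  have hpos := sib_pos huF (Finset.mem_singleton_self l)
  rw [finrank_solutionSpace ha huF, Finset.prod_singleton, sibi,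
    Set.ncard_image_of_injective _ (Function.update_injective u l), Nat.cast_sub hpos,
    Nat.cast_one]

/-! ### Diagonalization of the reproducing kernel -/

/-- A nonzero dimension requires at least two siblings in every direction of `F`, which bounds the
depth by the branching index. This is where finite joint branching index enters. -/
lemma finite_solutionSpace_ne_zero {a : ℕ} (ha : 0 < a) (hT : FiniteJointBranchingIndex T)
    (F : Finset (Fin d)) :
    {u | u ∈ Phi T F ∧ Module.finrank ℂ (solutionSpace T a F u) ≠ 0}.Finite := by
  refine (Set.Finite.pi' (t := fun j => ⋃ n ∈ Finset.range ((T j).branchingIndex.toNat + 1),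
    (T j).generation n) fun j => Set.Finite.biUnion (Finset.finite_toSet _) fun n _ =>
    RootedTree.finite_generation n).subset ?_
  rintro u ⟨huF, hne⟩ j
  rw [finrank_solutionSpace ha huF] at hne
  simp only [Set.mem_iUnion]
  refine ⟨(T j).depth (u j), ?_, rfl⟩
  rw [Finset.mem_range, Nat.lt_succ_iff]
  by_cases hj : j ∈ F
  · have h2 : 2 ≤ ((T j).sib (u j)).ncard := by
      have := Finset.prod_ne_zero_iff.1 hne j hj
      omega
    have h := RootedTree.depth_le_branchingIndex (huF.1 j hj) h2
    rw [← ENat.natCast_toNat (hT j)] at h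
    exact_mod_cast h
  · rw [huF.2 j hj, RootedTree.depth_eq_zero_iff.2 rfl]
    exact Nat.zero_le _

lemma eq_of_mem_sibF {Ω : Finset (Fin d) → Set (∀ j, V j)} (hΩ : ∀ F, IsIndexingSet T F (Ω F))
    {F F' : Finset (Fin d)} {u u' v : ∀ j, V j} (hu : u ∈ Ω F) (hu' : u' ∈ Ω F')
    (hv : v ∈ sibF T F u) (hv' : v ∈ sibF T F' u') : F = F' ∧ u = u' := by
  have h1 := mem_Phi_of_mem_sibF ((hΩ F).1 hu) hv
  have h2 := mem_Phi_of_mem_sibF ((hΩ F').1 hu') hv'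
  obtain rfl : F = F' := by
    ext j
    rw [mem_iff_depth_ne_zero h1, mem_iff_depth_ne_zero h2]
  exact ⟨rfl, ((hΩ F).2 v h1).unique ⟨hu, hv⟩ ⟨hu', hv'⟩⟩

/-- Distinct sibling classes are disjoint, also across different `F`, so the supports are disjoint.
-/
lemma inner_eq_zero_of_solutionSpace {a : ℕ} {Ω : Finset (Fin d) → Set (∀ j, V j)}
    (hΩ : ∀ F, IsIndexingSet T F (Ω F)) {F F' : Finset (Fin d)} {u u' : ∀ j, V j}
    (hu : u ∈ Ω F) (hu' : u' ∈ Ω F') (hne : ¬ (F = F' ∧ u = u')) {f g : L2 V}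
    (hf : f ∈ solutionSpace T a F u) (hg : g ∈ solutionSpace T a F' u') : ⟪f, g⟫_ℂ = 0 := by
  rw [lp.inner_eq_tsum]
  refine (tsum_congr fun v => ?_).trans tsum_zero
  by_cases hv : v ∈ sibF T F u
  · have hv' : v ∉ sibF T F' u' := fun hv' => hne (eq_of_mem_sibF hΩ hu hu' hv hv')
    rw [hg.1 v hv', inner_zero_right]
  · rw [hf.1 v hv, inner_zero_left]

/-- `𝓛_{u,F}` as a subspace of `E` and as a subspace of `ℓ²(V)` are isomorphic. -/
def solutionSpaceEEquiv {a : ℕ} (ha : 0 < a) {F : Finset (Fin d)} {u : ∀ j, V j}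
    (hu : u ∈ Phi T F) : solutionSpaceE T a F u ≃ₗ[ℂ] solutionSpace T a F u :=
  Submodule.comapSubtypeEquivOfLe (solutionSpace_le_jointKernel ha hu)

/-- The reproducing kernel is diagonal with respect to a finite orthonormal family, and the number
of members of a given type is the corresponding sum of dimensions. -/
lemma exists_diagonalization {a : ℕ} (ha : 0 < a) (hT : FiniteJointBranchingIndex T)
    {Ω : Finset (Fin d) → Set (∀ j, V j)} (hΩ : ∀ F, IsIndexingSet T F (Ω F)) :
    ∃ (n : ℕ) (δ : Fin n → Fin d → ℕ) (b : Fin n → jointKernel T a), Orthonormal ℂ b ∧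
      (∀ z w v, daKernel T a Ω z w v = ∑ i, scalarKernel a (δ i) z w • ⟪b i, v⟫_ℂ • b i) ∧
      ∀ α, Fintype.card {i // δ i = α} = ∑ F, ∑ᶠ u ∈ {u | u ∈ Ω F ∧ depth T u = α},
        Module.finrank ℂ (solutionSpace T a F u) := by
  classical
  have hfin : ∀ F, {u | u ∈ Ω F ∧ Module.finrank ℂ (solutionSpace T a F u) ≠ 0}.Finite := fun F =>
    (finite_solutionSpace_ne_zero ha hT F).subset fun u hu => ⟨(hΩ F).1 hu.1, hu.2⟩
  set S : Finset (Fin d) → Finset (∀ j, V j) := fun F => (hfin F).toFinset with hS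
  have hSmem : ∀ {F u}, u ∈ S F ↔ u ∈ Ω F ∧ Module.finrank ℂ (solutionSpace T a F u) ≠ 0 :=
    fun {F u} => (hfin F).mem_toFinset
  have hPhi : ∀ F, ∀ u ∈ Ω F, u ∈ Phi T F := fun F u hu => (hΩ F).1 hu
  have hfd : ∀ F, ∀ u ∈ Ω F, FiniteDimensional ℂ (solutionSpaceE T a F u) := fun F u hu => by
    have := finiteDimensional_solutionSpace ha (hPhi F u hu)
    exact (solutionSpaceEEquiv ha (hPhi F u hu)).symm.finiteDimensional
  have hrank : ∀ F, ∀ u ∈ Ω F, Module.finrank ℂ (solutionSpaceE T a F u) =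
      Module.finrank ℂ (solutionSpace T a F u) := fun F u hu =>
    (solutionSpaceEEquiv ha (hPhi F u hu)).finrank_eq
  have hbasis : ∀ (F : Finset (Fin d)) (u : S F), ∃ b : Fin (Module.finrank ℂ
      (solutionSpace T a F u)) → jointKernel T a, Orthonormal ℂ b ∧
      (∀ k, (b k : L2 V) ∈ solutionSpace T a F u) ∧
      ∀ v, (solutionSpaceE T a F u).starProjection v = ∑ k, ⟪b k, v⟫_ℂ • b k := by
    intro F u
    have huΩ := (hSmem.1 u.2).1
    have := hfd F u huΩ
    set B := (stdOrthonormalBasis ℂ (solutionSpaceE T a F u)).reindex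
      (finCongr (hrank F u huΩ)) with hB
    refine ⟨fun k => B k, ?_, fun k => (B k).2, fun v => ?_⟩
    · exact B.orthonormal.comp_linearIsometry (solutionSpaceE T a F u).subtypeₗᵢ
    · rw [B.starProjection_eq_sum_rankOne]
      simp
  choose b hbo hbmem hbproj using hbasis
  set I := Σ (F : Finset (Fin d)) (u : S F), Fin (Module.finrank ℂ (solutionSpace T a F u))
  set e : I ≃ Fin (Fintype.card I) := Fintype.equivFin I
  set β : I → jointKernel T a := fun i => b i.1 i.2.1 i.2.2 with hβ
  set δ : I → Fin d → ℕ := fun i => depth T (i.2.1 : ∀ j, V j) with hδ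
  have hβo : Orthonormal ℂ β := by
    rw [orthonormal_iff_ite]
    rintro ⟨F, u, k⟩ ⟨F', u', k'⟩
    by_cases h : F = F' ∧ (u : ∀ j, V j) = u'
    · obtain ⟨rfl, h⟩ := h
      obtain rfl : u = u' := Subtype.ext h
      have := orthonormal_iff_ite.1 (hbo F u) k k'
      refine this.trans (if_congr ⟨?_, ?_⟩ rfl rfl)
      · rintro rfl
        rfl
      · intro h
        cases h
        rfl
    · rw [if_neg]
      · exact inner_eq_zero_of_solutionSpace hΩ (hSmem.1 u.2).1 (hSmem.1 u'.2).1 h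
          (hbmem F u k) (hbmem F' u' k')
      · intro h'
        cases h'
        exact h ⟨rfl, rfl⟩
  have hker : ∀ z w v, daKernel T a Ω z w v = ∑ i, scalarKernel a (δ i) z w • ⟪β i, v⟫_ℂ • β i := by
    intro z w v
    -- Outside `S F` the solution space is zero, hence so is its projection, and the sum over `Ω F`
    -- is finite.
    have hblock : ∀ F, ∑ᶠ u ∈ Ω F, blockKernel T a F u = ∑ u ∈ S F, blockKernel T a F u := by
      intro F
      refine finsum_mem_eq_sum_of_subset _ ?_ fun u hu => (hSmem.1 hu).1
      rintro u ⟨huΩ, hu⟩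
      refine hSmem.2 ⟨huΩ, fun h0 => hu ?_⟩
      have := hfd F u huΩ
      rw [← hrank F u huΩ, Submodule.finrank_eq_zero] at h0
      ext z w : 2
      simp [blockKernel, h0]
    simp only [daKernel, hblock, Matrix.sum_apply, sum_apply]
    rw [Fintype.sum_sigma]
    refine Finset.sum_congr rfl fun F _ => ?_
    rw [Fintype.sum_sigma, ← Finset.sum_coe_sort]
    refine Finset.sum_congr rfl fun u _ => ?_
    change scalarKernel a (depth T u) z w • (solutionSpaceE T a F u).starProjection v = _
    rw [hbproj, Finset.smul_sum]
  have hcard : ∀ α, ∑ i, (if δ i = α then 1 else 0) = ∑ F, ∑ᶠ u ∈ {u | u ∈ Ω F ∧ depth T u = α},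
        Module.finrank ℂ (solutionSpace T a F u) := by
    intro α
    rw [Fintype.sum_sigma]
    refine Finset.sum_congr rfl fun F _ => ?_
    rw [Fintype.sum_sigma, finsum_mem_eq_sum_of_subset (t := (S F).filter fun u => depth T u = α),
      Finset.sum_filter, ← Finset.sum_coe_sort (S F) fun u : ∀ j, V j =>
        if depth T u = α then Module.finrank ℂ (solutionSpace T a F u) else 0]
    · refine Finset.sum_congr rfl fun u _ => ?_
      simp [hδ]
    · rintro u ⟨⟨huΩ, hu⟩, h0⟩
      exact Finset.mem_coe.2 (Finset.mem_filter.2 ⟨hSmem.2 ⟨huΩ, h0⟩, hu⟩)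
    · intro u hu
      obtain ⟨h1, h2⟩ := Finset.mem_filter.1 (Finset.mem_coe.1 hu)
      exact ⟨(hSmem.1 h1).1, h2⟩
  refine ⟨Fintype.card I, δ ∘ e.symm, β ∘ e.symm, hβo.comp _ e.symm.injective, ?_, ?_⟩
  · intro z w v
    rw [hker, ← Equiv.sum_comp e.symm]
    rfl
  · intro α
    rw [← hcard, ← Equiv.sum_comp e.symm, Fintype.card_subtype, Finset.card_filter]
    rfl

/-- Two families of types with the same multiplicities are matched by a bijection. -/
lemma exists_equiv_of_card_fiber {I J A : Type*} [Fintype I] [Fintype J] [DecidableEq A] (f : I → A)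
    (g : J → A) (h : ∀ x, Fintype.card {i // f i = x} = Fintype.card {j // g j = x}) :
    ∃ σ : I ≃ J, ∀ i, g (σ i) = f i := by
  refine ⟨(Equiv.sigmaFiberEquiv f).symm.trans ((Equiv.sigmaCongrRight fun x =>
    Fintype.equivOfCardEq (h x)).trans (Equiv.sigmaFiberEquiv g)), fun i => ?_⟩
  exact (Fintype.equivOfCardEq (h (f i)) ⟨i, rfl⟩).2

/-- Two Hilbert modules are isomorphic if and only if they have the same multiplicities. -/
lemma areIsomorphic_iff {W : Fin d → Type*} {T' : ∀ j, RootedTree (W j)} {a : ℕ} (ha : 0 < a)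
    (had : a * d ≠ 1) (hT : FiniteJointBranchingIndex T) (hT' : FiniteJointBranchingIndex T')
    {Ω : Finset (Fin d) → Set (∀ j, V j)} (hΩ : ∀ F, IsIndexingSet T F (Ω F))
    {Ω' : Finset (Fin d) → Set (∀ j, W j)} (hΩ' : ∀ F, IsIndexingSet T' F (Ω' F)) :
    AreIsomorphic a T Ω T' Ω' ↔ ∀ α : Fin d → ℕ,
      ∑ F, ∑ᶠ u ∈ {u | u ∈ Ω F ∧ depth T u = α}, Module.finrank ℂ (solutionSpace T a F u) =
      ∑ F, ∑ᶠ u ∈ {u | u ∈ Ω' F ∧ depth T' u = α}, Module.finrank ℂ (solutionSpace T' a F u) := by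
  obtain ⟨n, δ, b, hb, hker, hcard⟩ := exists_diagonalization ha hT hΩ
  obtain ⟨n', δ', b', hb', hker', hcard'⟩ := exists_diagonalization ha hT' hΩ'
  simp only [← hcard, ← hcard']
  obtain ⟨U, hU⟩ := exists_model (H := DAModule T a Ω) ha δ b hb (by
    rw [kernel_DAModule]
    exact hker)
  constructor
  · rintro ⟨W, hW⟩ α
    obtain ⟨U', hU'⟩ := exists_model (H := DAModule T' a Ω') ha δ' b' hb' (by
      rw [kernel_DAModule]
      exact hker')
    refine card_eq_of_intertwining ha had ((U.symm.trans W).trans U') (fun k F G => ?_) α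
    obtain ⟨f, rfl⟩ := U.surjective F
    obtain ⟨g, rfl⟩ := U.surjective G
    have h := (hU k f g).symm.trans ((hW k f g).trans (hU' k (W f) (W g)))
    simpa using h
  · intro h
    obtain ⟨σ, hσ⟩ := exists_equiv_of_card_fiber δ δ' h
    -- Reordering the second orthonormal family along `σ` gives both modules literally the same
    -- model.
    obtain ⟨U', hU'⟩ := exists_model (H := DAModule T' a Ω') ha δ (b' ∘ σ)
      (hb'.comp _ σ.injective) (by
        intro z w v
        rw [kernel_DAModule, hker', ← Equiv.sum_comp σ]
        simp only [hσ, Function.comp_apply])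
    refine ⟨U.trans U'.symm, fun k f g => ?_⟩
    have h1 := hU' k (U'.symm (U f)) (U'.symm (U g))
    rw [U'.apply_symm_apply, U'.apply_symm_apply] at h1
    exact (hU k f g).trans h1.symm

end

end DruryArveson

end

/-! ### The equivalence of the four conditions -/

theorem theorem1p4 (a d : ℕ) (ha : 0 < a) (hd : 0 < d) (had : a * d ≠ 1)
    {V₁ V₂ : Fin d → Type*}
    (T₁ : ∀ j, DruryArveson.RootedTree (V₁ j)) (T₂ : ∀ j, DruryArveson.RootedTree (V₂ j))
    (hT₁ : DruryArveson.FiniteJointBranchingIndex T₁)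
    (hT₂ : DruryArveson.FiniteJointBranchingIndex T₂)
    (Ω₁ : Finset (Fin d) → Set (∀ j, V₁ j)) (Ω₂ : Finset (Fin d) → Set (∀ j, V₂ j))
    (hΩ₁ : ∀ F, DruryArveson.IsIndexingSet T₁ F (Ω₁ F))
    (hΩ₂ : ∀ F, DruryArveson.IsIndexingSet T₂ F (Ω₂ F)) :
    List.TFAE [
      DruryArveson.AreIsomorphic a T₁ Ω₁ T₂ Ω₂,
      ∀ (α : Fin d → ℕ) (F : Finset (Fin d)),
        ∑ᶠ u ∈ {u | u ∈ Ω₁ F ∧ DruryArveson.depth T₁ u = α},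
            Module.finrank ℂ (DruryArveson.solutionSpace T₁ a F u) =
          ∑ᶠ v ∈ {v | v ∈ Ω₂ F ∧ DruryArveson.depth T₂ v = α},
            Module.finrank ℂ (DruryArveson.solutionSpace T₂ a F v),
      ∀ (n : ℕ) (l : Fin d),
        ∑ᶠ u ∈ {u | u ∈ Ω₁ {l} ∧ DruryArveson.depth T₁ u = Pi.single l n},
            (((DruryArveson.sibi T₁ l u).ncard : ℤ) - 1) =
          ∑ᶠ v ∈ {v | v ∈ Ω₂ {l} ∧ DruryArveson.depth T₂ v = Pi.single l n},
            (((DruryArveson.sibi T₂ l v).ncard : ℤ) - 1),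
      ∀ (n : ℕ) (l : Fin d),
        ((T₁ l).generation n).encard = ((T₂ l).generation n).encard] := by
  open DruryArveson in
  classical
  rw [areIsomorphic_iff ha had hT₁ hT₂ hΩ₁ hΩ₂]
  tfae_have 1 → 2 := by
    intro h α F
    by_cases hα : ∀ j, j ∈ F ↔ α j ≠ 0
    -- If `F` is the support of `α`, it contributes the only nonzero term to the multiplicity of
    -- `α`.
    · have hne : ∀ F', F' ≠ F → ¬ ∀ j, j ∈ F' ↔ α j ≠ 0 := fun F' hF' h' =>
        hF' (Finset.ext fun j => (h' j).trans (hα j).symm)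
      have h1 := h α
      rwa [Finset.sum_eq_single F, Finset.sum_eq_single F] at h1
      · intro F' _ hF'
        rw [not_mem_of_support_ne (hΩ₂ F').1 (hne F' hF'), finsum_mem_empty]
      · simp
      · intro F' _ hF'
        rw [not_mem_of_support_ne (hΩ₁ F').1 (hne F' hF'), finsum_mem_empty]
      · simp
    · rw [not_mem_of_support_ne (hΩ₁ F).1 hα, not_mem_of_support_ne (hΩ₂ F).1 hα,
        finsum_mem_empty, finsum_mem_empty]
  tfae_have 2 → 1 := fun h α => Finset.sum_congr rfl fun F _ => h α F
  tfae_have 2 → 3 := by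
    intro h n l
    rw [finsum_ncard_sibi ha (hΩ₁ {l}), finsum_ncard_sibi ha (hΩ₂ {l}), h]
  tfae_have 3 → 4 := by
    intro h n l
    rw [RootedTree.encard_generation, RootedTree.encard_generation]
    congr 1
    induction n with
    | zero => rw [RootedTree.gen_zero, RootedTree.gen_zero, Finset.card_singleton,
        Finset.card_singleton]
    | succ n ih =>
      have hα : ∀ j, j ∈ ({l} : Finset (Fin d)) ↔ (Pi.single l (n + 1) : Fin d → ℕ) j ≠ 0 := by
        intro j
        rcases eq_or_ne j l with rfl | hj
        · simp
        · simp [hj]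
      have h1 := h (n + 1) l
      rw [finsum_ncard_sibi ha (hΩ₁ {l}), finsum_ncard_sibi ha (hΩ₂ {l}),
        finsum_finrank_solutionSpace ha (hΩ₁ {l}) _ hα,
        finsum_finrank_solutionSpace ha (hΩ₂ {l}) _ hα, Finset.prod_singleton,
        Finset.prod_singleton, Pi.single_eq_same, Nat.add_sub_cancel] at h1
      -- Generations never shrink, so the truncated differences in `h1` are true differences and can
      -- be added to the induction hypothesis.
      have h2 := (T₁ l).card_gen_le_succ n
      have h3 := (T₂ l).card_gen_le_succ n
      have h4 : ((T₁ l).gen n).card = ((T₂ l).gen n).card := by exact_mod_cast ih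
      have h5 : ((T₁ l).gen (n + 1)).card = ((T₂ l).gen (n + 1)).card := by omega
      exact_mod_cast h5
  tfae_have 4 → 2 := by
    intro h α F
    have hc : ∀ n l, ((T₁ l).gen n).card = ((T₂ l).gen n).card := by
      intro n l
      have := h n l
      rw [RootedTree.encard_generation, RootedTree.encard_generation] at this
      exact_mod_cast this
    by_cases hα : ∀ j, j ∈ F ↔ α j ≠ 0
    · rw [finsum_finrank_solutionSpace ha (hΩ₁ F) α hα,
        finsum_finrank_solutionSpace ha (hΩ₂ F) α hα]
      exact Finset.prod_congr rfl fun j _ => by rw [hc, hc]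
    · rw [not_mem_of_support_ne (hΩ₁ F).1 hα, not_mem_of_support_ne (hΩ₂ F).1 hα,
        finsum_mem_empty, finsum_mem_empty]
  tfae_finish
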